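/- A weighted graph $G=(V,w,m)$ consists of a (possibly infinite) vertex set $V$, a symmetric function $w:V\times V\to[0,\infty)$ vanishing on the diagonal, and a vertex measure $m:V\to(0,\infty)$. Its combinatorial structure $\tilde G$ is the simple graph on $V$ in which $x\sim y$ iff $w(x,y)>0$. Write $\deg(x)=\#\{y: y\sim x\}$, $\deg_{\max}=\sup_x\deg(x)$, $\mathrm{Deg}(x)=\frac1{m(x)}\sum_y w(x,y)$ and $q(x,y)=w(x,y)/m(x)$. When all degrees are finite, define on functions $f,g:V\to\mathbb R$ $$\Delta f(x)=\frac1{m(x)}\sum_y w(x,y)(f(y)-f(x)),$$ $$2\Gamma(f,g)=\Delta(fg)-f\Delta g-g\Delta f,\qquad 2\Gamma_2(f,g)=\Delta\Gamma(f,g)-\Gamma(f,\Delta g)-\Gamma(g,\Delta f).$$ $G$ satisfies $CD(K,\infty)$ if $\Gamma_2(f,f)(x)\ge K\,\Gamma(f,f)(x)$ for all $f:V\to\mathbb R$ and all $x\in V$. For $D>0$, $\delta>1$ and an integer $d\ge1$, let $\mathcal G(D,d,\delta)$ be the class of weighted graphs with $\tilde G$ connected, $\deg_{\max}=d$, $\mathrm{Deg}(x)\le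 D$ and $\delta^{-1}\le m(x)\le\delta$ for all $x\in V$. If $V$ is finite, let $\lambda_0\le\lambda_1\le\dots\le\lambda_{|V|-1}$ be the eigenvalues of $-\Delta$, counted with multiplicity. The hypercube $H_d$ is the graph on $\{0,1\}^d$ in which two vertices are adjacent iff they differ in exactly one coordinate, and $H_d(c)$, for $c>0$, is the weighted graph with combinatorial structure $H_d$, with $w=c$ on edges and $m\equiv1$ (so $q(x,y)=c$ for all $x\sim y$). The Frobenius distance of two finite weighted graphs $G,H$ with equally many vertices is $$\operatorname{dist}_F(G,H)=\min_\pi\Big(\sum_{x,y\in V(G)}\big(q_G(x,y)-q_H(\pi(x),\pi(y))\big)^2\Big)^{1/2},$$ the minimum being over all bijections $\pi:V(G)\to V(H)$. Theorem. For every integer $d\ge1$ and every $K>0$ there is a constant $C=C(d,K)>0$ such that for all $D>0$ and $\delta>1$ there is $\epsilon_0=\epsilon_0(D,K,d,\delta)>0$ with the following property. Every $G\in\mathcal G(D,d,\delta)$ satisfying $CD(K,\infty)$ is finite, and if moreover $\lambda_d\le K+\epsilon_0$, then $\tilde G$ is isomorphic to the $d$-dimensional hypercube $H_d$, and $$\operatorname{dist}_F\big(G,H_d(K/2)\big)\le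 C\,(\lambda_d-K)^{1/2}.$$ -/

import Mathlib

/-- A weighted graph `(V, w, m)`: a symmetric edge weight `w : V × V → [0, ∞)` vanishing on the
diagonal, and a vertex measure `m : V → (0, ∞)`. The vertex set may be infinite. -/
structure WeightedGraph (V : Type*) where
  w : V → V → ℝ
  m : V → ℝ
  w_nonneg : ∀ x y, 0 ≤ w x y
  w_symm : ∀ x y, w x y = w y x
  w_self : ∀ x, w x x = 0
  m_pos : ∀ x, 0 < m x

/-- The combinatorial hypercube graph: vertices are the binary strings of length `d`, and two of
them are adjacent iff they differ in exactly one coordinate. -/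
def hypercubeGraph (d : ℕ) : SimpleGraph (Fin d → Bool) where
  Adj x y := ∃! i, x i ≠ y i
  symm := ⟨fun x y h => by simpa only [ne_comm] using h⟩
  loopless := ⟨fun x h => by simpa using h.exists⟩

namespace WeightedGraph

variable {V W : Type*}

/-- The underlying combinatorial structure: `x` and `y` are adjacent iff `w x y > 0`. -/
def toSimpleGraph (G : WeightedGraph V) : SimpleGraph V where
  Adj x y := 0 < G.w x y
  symm := ⟨fun x y h => by rwa [G.w_symm y x]⟩
  loopless := ⟨fun x h => by rw [G.w_self] at h; exact lt_irrefl 0 h⟩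

/-- The combinatorial degree of `x`: the number of neighbours, possibly infinite. -/
noncomputable def deg (G : WeightedGraph V) (x : V) : ℕ∞ := (G.toSimpleGraph.neighborSet x).encard

/-- The maximal combinatorial degree. -/
noncomputable def degMax (G : WeightedGraph V) : ℕ∞ := ⨆ x, G.deg x

/-- The weighted degree of `x`. (In a locally finite graph the sum has finite support.) -/
noncomputable def wdeg (G : WeightedGraph V) (x : V) : ℝ := (∑ᶠ y, G.w x y) / G.m x

/-- The edge degree `q(x, y) = w(x, y) / m(x)` of an oriented edge (zero if `x`, `y` are not
adjacent). -/
noncomputable def q (G : WeightedGraph V) (x y : V) : ℝ := G.w x y / G.m x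

/-- The class `𝒢(D, d, δ)`: connected weighted graphs of maximal combinatorial degree exactly `d`
(so in particular locally finite), weighted degrees at most `D` and vertex measure in
`[δ⁻¹, δ]`. -/
structure MemClass (G : WeightedGraph V) (D : ℝ) (d : ℕ) (δ : ℝ) : Prop where
  connected : G.toSimpleGraph.Connected
  degMax_eq : G.degMax = d
  wdeg_le : ∀ x, G.wdeg x ≤ D
  le_m : ∀ x, δ⁻¹ ≤ G.m x
  m_le : ∀ x, G.m x ≤ δ

/-- The graph Laplacian `Δ f (x) = (1 / m x) ∑ y, w x y * (f y - f x)`. (In a locally finite graph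
the sum has finite support.) -/
noncomputable def laplacian (G : WeightedGraph V) (f : V → ℝ) : V → ℝ :=
  fun x => (∑ᶠ y, G.w x y * (f y - f x)) / G.m x

/-- `2 Γ(f, g) = Δ(f g) - f Δ g - g Δ f`. -/
noncomputable def gam (G : WeightedGraph V) (f g : V → ℝ) : V → ℝ :=
  (1 / 2 : ℝ) • (G.laplacian (f * g) - f * G.laplacian g - g * G.laplacian f)

/-- `2 Γ₂(f, g) = Δ Γ(f, g) - Γ(f, Δ g) - Γ(g, Δ f)`. -/
noncomputable def gam2 (G : WeightedGraph V) (f g : V → ℝ) : V → ℝ :=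
  (1 / 2 : ℝ) •
    (G.laplacian (G.gam f g) - G.gam f (G.laplacian g) - G.gam g (G.laplacian f))

/-- The Bakry–Émery curvature-dimension condition `CD(K, ∞)`. -/
def CDInfty (G : WeightedGraph V) (K : ℝ) : Prop :=
  ∀ (f : V → ℝ) (x : V), K * G.gam f f x ≤ G.gam2 f f x

/-- The Laplacian of a finite weighted graph as a linear endomorphism of `C(V) = ℝ^V`. -/
noncomputable def laplacianLin (G : WeightedGraph V) [Finite V] :
    (V → ℝ) →ₗ[ℝ] (V → ℝ) where
  toFun := G.laplacian
  map_add' f g := by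
    funext x
    simp only [laplacian, Pi.add_apply]
    rw [← add_div, ← finsum_add_distrib (Set.toFinite _) (Set.toFinite _)]
    congr 1
    exact finsum_congr fun y => by ring
  map_smul' c f := by
    funext x
    simp only [laplacian, Pi.smul_apply, smul_eq_mul, RingHom.id_apply]
    rw [← mul_div_assoc, mul_finsum]
    congr 1
    exact finsum_congr fun y => by ring

/-- The eigenvalues `λ₀ ≤ λ₁ ≤ ⋯ ≤ λ_{|V| - 1}` of `-Δ` on a finite weighted graph, listed in
increasing order with multiplicity (as roots of the characteristic polynomial of `-Δ`). -/
noncomputable def spectrumList (G : WeightedGraph V) [Finite V] : List ℝ :=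
  (-G.laplacianLin).charpoly.roots.sort (· ≤ ·)

/-- The eigenvalue `λ_k` of `-Δ`, for `k < |V|`; the indexing starts with `λ₀ = 0`. -/
noncomputable def eigenvalue (G : WeightedGraph V) [Finite V] (k : ℕ) : ℝ :=
  G.spectrumList.getD k 0

/-- The Frobenius norm of a square matrix. -/
noncomputable def frobeniusNorm [Fintype V] (M : Matrix V V ℝ) : ℝ :=
  Real.sqrt (∑ x, ∑ y, M x y ^ 2)

/-- The matrix `A_G = (q(x, y))`. -/
noncomputable def edgeDegreeMatrix (G : WeightedGraph V) : Matrix V V ℝ := Matrix.of G.q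

/-- The Frobenius distance of two finite weighted graphs with the same number of vertices: the
minimum, over all bijections `π` between the vertex sets, of the Frobenius norm of
`A_G^π - A_H`. -/
noncomputable def frobeniusDist [Fintype V] [Fintype W] (G : WeightedGraph V)
    (H : WeightedGraph W) : ℝ :=
  ⨅ π : V ≃ W, frobeniusNorm (G.edgeDegreeMatrix.submatrix π.symm π.symm - H.edgeDegreeMatrix)

open Classical in
/-- The weighted hypercube `H_d(c)`: the hypercube graph with constant edge degree `c`, normalized
by `m = 1`. (In a connected graph of constant edge degree `m` is constant, so that only a common
factor of `w` and `m` is fixed by this, on which edge degrees do not depend.) -/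
noncomputable def hypercube (d : ℕ) (c : ℝ) (hc : 0 < c) : WeightedGraph (Fin d → Bool) where
  w x y := if (hypercubeGraph d).Adj x y then c else 0
  m _ := 1
  w_nonneg x y := by split_ifs <;> [exact hc.le; exact le_rfl]
  w_symm x y := by simp only [(hypercubeGraph d).adj_comm x y]
  w_self x := by simp
  m_pos _ := one_pos

end WeightedGraph

/-! Under CD(K,∞) the heat flow contracts gradients at rate K. The flow is run here as an explicit
Euler scheme, which needs only finite sums and no bound on the function, so it also works on an
infinite graph. Adding up the increments bounds the oscillation of f by sup Γ(f)
(`sq_sub_le_of_gam_le`). For f the distance to a vertex this is a Bonnet–Myers diameter bound, and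
bounded degree gives finiteness.

If λ_d ≤ K + ε, Lichnerowicz' inequality yields d orthonormal eigenfunctions f_i with eigenvalues in
[K, K + ε]. The curvature condition makes Γ(f_i + f_j) almost subharmonic, hence constant up to
O(√ε). After scaling, the matrix Γ(f_i, f_j) is therefore O(√ε)-close to the identity at every
vertex. Use the scaled f_i as coordinates of P : V → ℝ^d. Since x has at most d neighbours, Gram
duality (`sum_sq_gram_sub`) makes the edge vectors P y − P x almost orthogonal, with ½ q(x,y) |P y −
P x|² ≈ 1. Pairing the eigenvalue equation with an edge vector gives K⟨P x, P y − P x⟩ ≈ −2. Adding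
the two ends of the edge gives K|P y − P x|² ≈ 4, hence q(x,y) ≈ K/2. These estimates need a lower
bound for q on the edges.

For ε = 0 everything is exact. Equality in CD, tested against indicators of vertices at distance
two, closes any two edges at a vertex to a parallelogram. Edge directions are then globally
parallel, and the signs of ⟨P x, E_i⟩ identify V with {0,1}^d (`exists_cube`).

For small ε, compactness (`exists_gap`) gives a cube with all rates within K/4 of the model; this
threshold depends on D and δ. Edge rates then lie in (K/4, 3K/4) and m varies by a factor at most
3^d. Normalizing m and rerunning the estimates gives constants depending on d and K alone
(`abs_q_sub_cubeRate_le`). -/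

namespace GraphKernel

/-! ### Γ-calculus of locally finite kernels -/

variable {V : Type*}

/-- The Laplacian of a locally finite kernel `q`, the sum at `x` running over `N x`. -/
def lap (N : V → Finset V) (q : V → V → ℝ) (f : V → ℝ) (x : V) : ℝ :=
  ∑ y ∈ N x, q x y * (f y - f x)

/-- The carré du champ of a locally finite kernel. -/
noncomputable def gam (N : V → Finset V) (q : V → V → ℝ) (f g : V → ℝ) (x : V) : ℝ :=
  1 / 2 * ∑ y ∈ N x, q x y * ((f y - f x) * (g y - g x))

/-- The iterated carré du champ of a locally finite kernel. -/
noncomputable def gam2 (N : V → Finset V) (q : V → V → ℝ) (f g : V → ℝ) (x : V) : ℝ :=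
  1 / 2 * (lap N q (gam N q f g) x - gam N q f (lap N q g) x - gam N q g (lap N q f) x)

/-- The curvature condition `CD(K, ∞)` for a locally finite kernel. -/
def CD (N : V → Finset V) (q : V → V → ℝ) (K : ℝ) : Prop :=
  ∀ (f : V → ℝ) (x : V), K * gam N q f f x ≤ gam2 N q f f x

variable {N : V → Finset V} {q : V → V → ℝ} {K D : ℝ}

theorem gam_comm (f g : V → ℝ) : gam N q f g = gam N q g f := by
  funext x
  simp only [gam, mul_comm (f _ - f x)]

theorem gam_add_left (f g h : V → ℝ) :
    gam N q (f + g) h = gam N q f h + gam N q g h := by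
  funext x
  simp only [gam, Pi.add_apply]
  rw [← mul_add, ← Finset.sum_add_distrib]
  congr 1
  exact Finset.sum_congr rfl fun y _ => by ring

theorem gam_smul_left (c : ℝ) (f h : V → ℝ) :
    gam N q (c • f) h = c • gam N q f h := by
  funext x
  simp only [gam, Pi.smul_apply, smul_eq_mul]
  simp only [Finset.mul_sum]
  refine Finset.sum_congr rfl fun y _ => ?_
  ring

theorem gam_add_right (f g h : V → ℝ) :
    gam N q f (g + h) = gam N q f g + gam N q f h := by
  rw [gam_comm, gam_add_left, gam_comm g, gam_comm h]

theorem gam_smul_right (c : ℝ) (f h : V → ℝ) :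
    gam N q f (c • h) = c • gam N q f h := by
  rw [gam_comm, gam_smul_left, gam_comm]

theorem lap_add (f g : V → ℝ) : lap N q (f + g) = lap N q f + lap N q g := by
  funext x
  simp only [lap, Pi.add_apply]
  rw [← Finset.sum_add_distrib]
  exact Finset.sum_congr rfl fun y _ => by ring

theorem lap_smul (c : ℝ) (f : V → ℝ) : lap N q (c • f) = c • lap N q f := by
  funext x
  simp only [lap, Pi.smul_apply, smul_eq_mul]
  rw [Finset.mul_sum]
  exact Finset.sum_congr rfl fun y _ => by ring

theorem gam_self_nonneg (hq : ∀ x y, 0 ≤ q x y) (f : V → ℝ) (x : V) : 0 ≤ gam N q f f x :=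
  mul_nonneg (by norm_num) (Finset.sum_nonneg fun y _ => mul_nonneg (hq x y) (mul_self_nonneg _))

theorem edge_le_gam_self (hq : ∀ x y, 0 ≤ q x y) (f : V → ℝ) {x y : V} (hy : y ∈ N x) :
    q x y * (f y - f x) ^ 2 ≤ 2 * gam N q f f x := by
  have := Finset.single_le_sum (f := fun y => q x y * ((f y - f x) * (f y - f x)))
    (fun y _ => mul_nonneg (hq x y) (mul_self_nonneg _)) hy
  simp only [gam]
  nlinarith

theorem lap_sq_le (hq : ∀ x y, 0 ≤ q x y) {x : V} (hD : ∑ y ∈ N x, q x y ≤ D) (f : V → ℝ) :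
    lap N q f x ^ 2 ≤ 2 * D * gam N q f f x := by
  have h1 : lap N q f x ^ 2 ≤ (∑ y ∈ N x, q x y) * ∑ y ∈ N x, q x y * ((f y - f x) * (f y - f x)) := by
    apply Finset.sum_sq_le_sum_mul_sum_of_sq_le_mul
    · exact fun y _ => hq x y
    · exact fun y _ => mul_nonneg (hq x y) (mul_self_nonneg _)
    · intro y _; exact (by ring : _ = _).le
  have h2 := gam_self_nonneg (N := N) hq f x
  have h3 : ∑ y ∈ N x, q x y * ((f y - f x) * (f y - f x)) = 2 * gam N q f f x := by
    simp only [gam]; ring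
  rw [h3] at h1
  nlinarith

theorem abs_gam_le (hq : ∀ x y, 0 ≤ q x y) {x : V} (hD : ∑ y ∈ N x, q x y ≤ D) {f g : V → ℝ}
    {A B : ℝ} (hA : ∀ x, |f x| ≤ A) (hB : ∀ x, |g x| ≤ B) : |gam N q f g x| ≤ 2 * D * A * B := by
  have hA0 : 0 ≤ A := (abs_nonneg _).trans (hA x)
  have hB0 : 0 ≤ B := (abs_nonneg _).trans (hB x)
  have key : |∑ y ∈ N x, q x y * ((f y - f x) * (g y - g x))| ≤ D * (2 * A * (2 * B)) := by
    calc |∑ y ∈ N x, q x y * ((f y - f x) * (g y - g x))|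
        ≤ ∑ y ∈ N x, |q x y * ((f y - f x) * (g y - g x))| := Finset.abs_sum_le_sum_abs _ _
      _ ≤ ∑ y ∈ N x, q x y * (2 * A * (2 * B)) := by
          refine Finset.sum_le_sum fun y _ => ?_
          rw [abs_mul, abs_of_nonneg (hq x y), abs_mul]
          refine mul_le_mul_of_nonneg_left ?_ (hq x y)
          refine mul_le_mul ?_ ?_ (abs_nonneg _) (by positivity)
          · linarith [abs_sub (f y) (f x), hA x, hA y]
          · linarith [abs_sub (g y) (g x), hB x, hB y]
      _ = (∑ y ∈ N x, q x y) * (2 * A * (2 * B)) := (Finset.sum_mul _ _ _).symm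
      _ ≤ _ := mul_le_mul_of_nonneg_right hD (by positivity)
  rw [gam, abs_mul, abs_of_pos (by norm_num : (0 : ℝ) < 1 / 2)]
  linarith

/-! ### Gradient contraction and the oscillation bound -/

/-- One explicit Euler step of the heat flow. -/
noncomputable def eulerStep (N : V → Finset V) (q : V → V → ℝ) (h : ℝ) (f : V → ℝ) : V → ℝ :=
  f + h • lap N q f

/-- Expand Γ(f + hΔf). CD bounds the cross term 2Γ(f, Δf) by ΔΓ(f) − 2KΓ(f), and ΔΓ(f) ≤ D(B −
Γ(f)). The quadratic term is at most 4D²Bh², which costs one of the two available hKB by `hstep'`;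
`hstep` keeps the coefficient of Γ(f) nonnegative. `stepSize` meets both conditions. -/
theorem gam_eulerStep_le (hq : ∀ x y, 0 ≤ q x y) (hD : ∀ x, ∑ y ∈ N x, q x y ≤ D)
    (hCD : CD N q K) {h B : ℝ} (hh : 0 ≤ h) (hstep : h * (2 * K + D) ≤ 1)
    (hstep' : 4 * D ^ 2 * h ≤ K) {f : V → ℝ} (hf : ∀ x, gam N q f f x ≤ B) (x : V) :
    gam N q (eulerStep N q h f) (eulerStep N q h f) x ≤ (1 - h * K) * B := by
  have hB : 0 ≤ B := (gam_self_nonneg hq f x).trans (hf x)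
  have hD0 : 0 ≤ D := (Finset.sum_nonneg fun y _ => hq x y).trans (hD x)
  have hlap : ∀ y, |lap N q f y| ≤ Real.sqrt (2 * D * B) := fun y =>
    Real.abs_le_sqrt ((lap_sq_le hq (hD y) f).trans
      (mul_le_mul_of_nonneg_left (hf y) (by positivity)))
  have h4 := abs_le.1 (abs_gam_le hq (hD x) hlap hlap)
  have hsq : Real.sqrt (2 * D * B) * Real.sqrt (2 * D * B) = 2 * D * B :=
    Real.mul_self_sqrt (by positivity)
  have hexp : gam N q (eulerStep N q h f) (eulerStep N q h f) x =
      gam N q f f x + 2 * h * gam N q f (lap N q f) x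
        + h ^ 2 * gam N q (lap N q f) (lap N q f) x := by
    simp only [eulerStep, gam_add_left, gam_add_right, gam_smul_left, gam_smul_right,
      Pi.add_apply, Pi.smul_apply, smul_eq_mul, gam_comm (lap N q f) f]
    ring
  have hcd := hCD f x
  simp only [gam2] at hcd
  have hl : lap N q (gam N q f f) x ≤ (∑ y ∈ N x, q x y) * (B - gam N q f f x) := by
    rw [Finset.sum_mul]
    exact Finset.sum_le_sum fun y _ => mul_le_mul_of_nonneg_left (by linarith [hf y]) (hq x y)
  have hl' : lap N q (gam N q f f) x ≤ D * (B - gam N q f f x) :=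
    hl.trans (mul_le_mul_of_nonneg_right (hD x) (by linarith [hf x]))
  rw [hexp]
  have e1 : 2 * gam N q f (lap N q f) x ≤ D * (B - gam N q f f x) - 2 * K * gam N q f f x := by
    linarith
  have e2 : gam N q (lap N q f) (lap N q f) x ≤ 4 * D ^ 2 * B := by
    calc _ ≤ 2 * D * Real.sqrt (2 * D * B) * Real.sqrt (2 * D * B) := h4.2
      _ = 4 * D ^ 2 * B := by rw [mul_assoc, hsq]; ring
  have e3 : h * (2 * gam N q f (lap N q f) x) ≤
      h * (D * (B - gam N q f f x) - 2 * K * gam N q f f x) := mul_le_mul_of_nonneg_left e1 hh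
  have e4 : h ^ 2 * gam N q (lap N q f) (lap N q f) x ≤ h ^ 2 * (4 * D ^ 2 * B) :=
    mul_le_mul_of_nonneg_left e2 (by positivity)
  have e5 : h * B * (4 * D ^ 2 * h) ≤ h * B * K := mul_le_mul_of_nonneg_left hstep' (by positivity)
  have e6 : (1 - h * (2 * K + D)) * gam N q f f x ≤ (1 - h * (2 * K + D)) * B :=
    mul_le_mul_of_nonneg_left (hf x) (by linarith)
  nlinarith

/-- The step size used for the explicit Euler scheme. -/
noncomputable def stepSize (D K : ℝ) : ℝ := 1 / (2 * K + D + 4 * D ^ 2 / K)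

/-- The constant in the oscillation estimate `sq_sub_le_of_gam_le`. -/
noncomputable def oscConst (D K : ℝ) : ℝ :=
  (2 * (stepSize D K * Real.sqrt (2 * D) / (1 - Real.sqrt (1 - stepSize D K * K)))) ^ 2

theorem stepSize_pos (hK : 0 < K) (hD : 0 ≤ D) : 0 < stepSize D K := by
  unfold stepSize; positivity

theorem stepSize_mul_le (hK : 0 < K) (hD : 0 ≤ D) : stepSize D K * (2 * K + D) ≤ 1 := by
  unfold stepSize
  rw [one_div, inv_mul_le_iff₀ (by positivity)]
  have : 0 ≤ 4 * D ^ 2 / K := by positivity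
  linarith

theorem mul_stepSize_le (hK : 0 < K) (hD : 0 ≤ D) : 4 * D ^ 2 * stepSize D K ≤ K := by
  unfold stepSize
  rw [mul_one_div, div_le_iff₀ (by positivity)]
  have : K * (4 * D ^ 2 / K) = 4 * D ^ 2 := by field_simp
  nlinarith

theorem sqrt_one_sub_stepSize_lt_one (hK : 0 < K) (hD : 0 ≤ D) :
    Real.sqrt (1 - stepSize D K * K) < 1 := by
  rw [Real.sqrt_lt' one_pos]
  nlinarith [mul_pos (stepSize_pos hK hD) hK]

theorem oscConst_nonneg (D K : ℝ) : 0 ≤ oscConst D K := sq_nonneg _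

/-- The Euler iterates move each value by a geometrically decaying amount, so f stays within a/(1 −
r) of all of them, while the differences of the iterates between two vertices tend to zero. No
boundedness of f is assumed, so the distance function of a possibly infinite graph is admissible. -/
theorem sq_sub_le_of_gam_le (hq : ∀ x y, 0 ≤ q x y) (hD : ∀ x, ∑ y ∈ N x, q x y ≤ D)
    (hK : 0 < K) (hCD : CD N q K)
    (hconn : ∀ x y, Relation.ReflTransGen (fun x y => y ∈ N x ∧ 0 < q x y) x y)
    {f : V → ℝ} {B : ℝ} (hf : ∀ x, gam N q f f x ≤ B) (x y : V) :
    (f x - f y) ^ 2 ≤ oscConst D K * B := by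
  have hB : 0 ≤ B := (gam_self_nonneg hq f x).trans (hf x)
  have hD0 : 0 ≤ D := (Finset.sum_nonneg fun y _ => hq x y).trans (hD x)
  set h := stepSize D K with hh
  have hpos : 0 < h := stepSize_pos hK hD0
  set r := Real.sqrt (1 - h * K) with hr
  have hr1 : r < 1 := sqrt_one_sub_stepSize_lt_one hK hD0
  have hr0 : 0 ≤ r := Real.sqrt_nonneg _
  have hhK : 0 ≤ 1 - h * K := by
    have := stepSize_mul_le hK hD0
    nlinarith [mul_nonneg hpos.le hD0, mul_pos hpos hK]
  have hrr : r ^ 2 = 1 - h * K := Real.sq_sqrt hhK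
  let F : ℕ → V → ℝ := fun n => (eulerStep N q h)^[n] f
  have hF : ∀ n, F (n + 1) = F n + h • lap N q (F n) := fun n => by
    simp only [F, Function.iterate_succ_apply']; rfl
  have hG : ∀ n x, gam N q (F n) (F n) x ≤ (r ^ n) ^ 2 * B := by
    intro n
    induction n with
    | zero => intro x; simpa [F] using hf x
    | succ n ih =>
      intro x
      have := gam_eulerStep_le hq hD hCD hpos.le (stepSize_mul_le hK hD0)
        (mul_stepSize_le hK hD0) ih x
      calc gam N q (F (n + 1)) (F (n + 1)) x ≤ (1 - h * K) * ((r ^ n) ^ 2 * B) := by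
            simpa only [F, Function.iterate_succ_apply'] using this
        _ = (r ^ (n + 1)) ^ 2 * B := by rw [← hrr]; ring
  set a := h * Real.sqrt (2 * D) * Real.sqrt B with ha
  have hstep : ∀ n x, |F (n + 1) x - F n x| ≤ a * r ^ n := by
    intro n x
    have h1 : |lap N q (F n) x| ≤ Real.sqrt (2 * D) * (r ^ n * Real.sqrt B) := by
      refine (Real.abs_le_sqrt ((lap_sq_le hq (hD x) (F n)).trans
        (mul_le_mul_of_nonneg_left (hG n x) (by positivity)))).trans_eq ?_
      rw [Real.sqrt_mul (x := 2 * D) (by positivity),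
        Real.sqrt_mul (x := (r ^ n) ^ 2) (by positivity), Real.sqrt_sq (by positivity)]
    rw [hF]
    simp only [Pi.add_apply, Pi.smul_apply, smul_eq_mul, add_sub_cancel_left, abs_mul,
      abs_of_pos hpos]
    calc h * |lap N q (F n) x| ≤ h * (Real.sqrt (2 * D) * (r ^ n * Real.sqrt B)) :=
          mul_le_mul_of_nonneg_left h1 hpos.le
      _ = a * r ^ n := by rw [ha]; ring
  have ha0 : 0 ≤ a := by positivity
  have hdist : ∀ n x, |F n x - f x| ≤ a / (1 - r) := by
    intro n x
    have h1 : |F n x - f x| ≤ ∑ k ∈ Finset.range n, a * r ^ k := by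
      have := Finset.sum_range_sub (fun n => F n x) n
      have h0 : F 0 x = f x := rfl
      rw [h0] at this
      rw [← this]
      exact (Finset.abs_sum_le_sum_abs _ _).trans (Finset.sum_le_sum fun k _ => hstep k x)
    refine h1.trans ?_
    rw [← Finset.mul_sum, div_eq_mul_inv]
    refine mul_le_mul_of_nonneg_left ?_ ha0
    rw [← tsum_geometric_of_lt_one hr0 hr1]
    exact (summable_geometric_of_lt_one hr0 hr1).sum_le_tsum _ fun _ _ => by positivity
  -- Γ(F n) → 0 forces the difference across each edge to vanish; a path carries this to x and y.
  have hlim : Filter.Tendsto (fun n => F n x - F n y) Filter.atTop (nhds 0) := by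
    induction hconn x y with
    | refl => simp
    | @tail u v _ huv ih =>
      have hedge : Filter.Tendsto (fun n => F n u - F n v) Filter.atTop (nhds 0) := by
        have hsq : Filter.Tendsto (fun n => 2 * ((r ^ n) ^ 2 * B) / q u v) Filter.atTop (nhds 0) := by
          have := (((tendsto_pow_atTop_nhds_zero_of_lt_one hr0 hr1).pow 2).mul_const B).const_mul 2
          simpa using this.div_const (q u v)
        have h0 : Filter.Tendsto (fun n => |F n u - F n v|) Filter.atTop (nhds 0) := by
          refine squeeze_zero (g := fun n => Real.sqrt (2 * ((r ^ n) ^ 2 * B) / q u v))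
            (fun _ => abs_nonneg _) (fun n => Real.abs_le_sqrt ?_) (by simpa using hsq.sqrt)
          rw [le_div_iff₀ huv.2]
          have := edge_le_gam_self hq (F n) huv.1
          nlinarith [hG n u]
        exact (tendsto_zero_iff_abs_tendsto_zero _).2 h0
      simpa using ih.add hedge
  have hbound : |f x - f y| ≤ 2 * (a / (1 - r)) := by
    have : ∀ n, |f x - f y| ≤ 2 * (a / (1 - r)) + |F n x - F n y| := by
      intro n
      have e1 := hdist n x
      have e2 := hdist n y
      rw [abs_le] at e1 e2
      have e3 := abs_le.1 (le_refl |F n x - F n y|)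
      rw [abs_le]
      constructor <;> linarith
    have h2 := (hlim.abs).const_add (2 * (a / (1 - r)))
    simp only [abs_zero, add_zero] at h2
    exact ge_of_tendsto' h2 this
  calc (f x - f y) ^ 2 = |f x - f y| ^ 2 := (sq_abs _).symm
    _ ≤ (2 * (a / (1 - r))) ^ 2 := pow_le_pow_left₀ (abs_nonneg _) hbound 2
    _ = oscConst D K * B := by
      have : a / (1 - r) = h * Real.sqrt (2 * D) / (1 - r) * Real.sqrt B := by rw [ha]; ring
      have hB2 := Real.sq_sqrt hB
      rw [this, oscConst, ← hh, ← hr, ← mul_assoc, mul_pow, hB2]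

end GraphKernel

/-! ### Eigenfunctions near the spectral bound have almost constant Γ -/

namespace GraphKernel

open Finset

variable {V : Type*} [Fintype V]

/-- All sums run over the whole vertex set. -/
abbrev full (V : Type*) [Fintype V] : V → Finset V := fun _ => univ

/-- Finite reversible kernels with at most `d` neighbours at each vertex, total rates at most `D`,
reversing measure in `[δ⁻¹, δ]`, curvature at least `K`, and a Poincaré inequality. -/
structure Regular (q : V → V → ℝ) (m : V → ℝ) (d : ℕ) (D δ K c : ℝ) : Prop where
  nonneg : ∀ x y, 0 ≤ q x y
  diag : ∀ x, q x x = 0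
  rev : ∀ x y, m x * q x y = m y * q y x
  le_m : ∀ x, δ⁻¹ ≤ m x
  m_le : ∀ x, m x ≤ δ
  sum_le : ∀ x, ∑ y, q x y ≤ D
  card_le : ∀ (x : V) (S : Finset V), d < S.card → ∃ y ∈ S, q x y = 0
  cd : CD (full V) q K
  osc : ∀ (f : V → ℝ) (x y : V), (f x - f y) ^ 2 ≤ c * ∑ z, gam (full V) q f f z

/-- An `m`-orthonormal family of eigenfunctions of `-Δ` with eigenvalues in `[K, K + ε]`. -/
structure EigenFrame {d : ℕ} (q : V → V → ℝ) (m : V → ℝ) (K ε : ℝ) (f : Fin d → V → ℝ)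
    (μ : Fin d → ℝ) : Prop where
  orth : ∀ i j, ∑ x, m x * (f i x * f j x) = if i = j then 1 else 0
  eig : ∀ i x, lap (full V) q (f i) x = -(μ i * f i x)
  le_mu : ∀ i, K ≤ μ i
  mu_le : ∀ i, μ i ≤ K + ε

variable {q : V → V → ℝ} {m : V → ℝ} {d : ℕ} {D δ K c ε : ℝ}

/-- Green's formula: reversibility lets the two ends of every edge be exchanged. -/
theorem sum_mul_lap (hrev : ∀ x y, m x * q x y = m y * q y x) (f g : V → ℝ) :
    ∑ x, m x * (g x * lap (full V) q f x) = -∑ x, m x * gam (full V) q f g x := by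
  have e1 : ∑ x, m x * (g x * lap (full V) q f x) =
      ∑ x, ∑ y, m x * q x y * (g x * (f y - f x)) := by
    refine sum_congr rfl fun x _ => ?_
    rw [lap, mul_sum, mul_sum]
    exact sum_congr rfl fun y _ => by ring
  have e2 : ∑ x, ∑ y, m x * q x y * (g x * (f y - f x)) =
      ∑ x, ∑ y, m x * q x y * (g y * (f x - f y)) := by
    rw [sum_comm]
    refine sum_congr rfl fun x _ => sum_congr rfl fun y _ => ?_
    rw [hrev]
  have e3 : ∑ x, m x * gam (full V) q f g x =
      1 / 2 * ∑ x, ∑ y, m x * q x y * ((f y - f x) * (g y - g x)) := by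
    rw [mul_sum]
    refine sum_congr rfl fun x _ => ?_
    rw [gam, mul_left_comm, mul_sum]
    refine congrArg _ (sum_congr rfl fun y _ => ?_)
    ring
  have e4 : ∑ x, ∑ y, m x * q x y * ((f y - f x) * (g y - g x)) =
      -(∑ x, ∑ y, m x * q x y * (g y * (f x - f y))) -
        ∑ x, ∑ y, m x * q x y * (g x * (f y - f x)) := by
    rw [← sum_neg_distrib, ← sum_sub_distrib]
    refine sum_congr rfl fun x _ => ?_
    rw [← sum_neg_distrib, ← sum_sub_distrib]
    exact sum_congr rfl fun y _ => by ring
  rw [e3, e4, e1, ← e2]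
  ring

namespace Regular

variable (h : Regular q m d D δ K c)
include h

theorem D_nonneg (x : V) : 0 ≤ D := (sum_nonneg fun y _ => h.nonneg x y).trans (h.sum_le x)

theorem q_le (x y : V) : q x y ≤ D :=
  (single_le_sum (f := fun y => q x y) (fun y _ => h.nonneg x y) (mem_univ y)).trans (h.sum_le x)

theorem m_pos (hδ : 0 < δ) (x : V) : 0 < m x := (inv_pos.2 hδ).trans_le (h.le_m x)

theorem sum_m_le : ∑ x, m x ≤ δ * Fintype.card V := by
  calc ∑ x, m x ≤ ∑ _x : V, δ := sum_le_sum fun x _ => h.m_le x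
    _ = _ := by simp [mul_comm]

/-- With H = Γ(g), CD and Δg = −Kg − r give ΔH ≥ −2Γ(g, r) ≥ −4DB²ε, as the terms KH cancel.
Integrating −HΔH bounds the Dirichlet energy of H by O(ε), and the Poincaré inequality turns this
into an oscillation bound. -/
theorem gam_sub_sq_le (hδ : 0 < δ) (hc : 0 ≤ c) (hε : 0 ≤ ε) {g r : V → ℝ} {B : ℝ}
    (hg : ∀ x, |g x| ≤ B) (hr : ∀ x, |r x| ≤ B * ε)
    (hlap : lap (full V) q g = -(K • g) - r) (x y : V) :
    (gam (full V) q g g x - gam (full V) q g g y) ^ 2 ≤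
      c * (δ * (8 * D ^ 2 * B ^ 4 * ε * ∑ z, m z)) := by
  have hD := h.D_nonneg x
  set H := gam (full V) q g g with hH
  have hH0 : ∀ x, 0 ≤ H x := gam_self_nonneg h.nonneg g
  have hH1 : ∀ x, H x ≤ 2 * D * B * B := fun x =>
    (abs_le.1 (abs_gam_le h.nonneg (h.sum_le x) hg hg)).2
  have hgr : ∀ x, gam (full V) q g r x ≤ 2 * D * B * (B * ε) := fun x =>
    (abs_le.1 (abs_gam_le h.nonneg (h.sum_le x) hg hr)).2
  have hlapH : ∀ x, 0 ≤ lap (full V) q H x + 4 * D * B ^ 2 * ε := by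
    intro x
    have h1 := h.cd g x
    have h2 : gam (full V) q g (lap (full V) q g) x = -(K * H x) - gam (full V) q g r x := by
      have e : lap (full V) q g = (-K) • g + (-1 : ℝ) • r := by
        rw [hlap]; funext x; simp; ring
      rw [e, gam_add_right, gam_smul_right, gam_smul_right, ← hH]
      simp; ring
    rw [gam2, h2, ← hH] at h1
    nlinarith [hgr x]
  have h3 : ∑ z, m z * gam (full V) q H H z ≤ 8 * D ^ 2 * B ^ 4 * ε * ∑ z, m z := by
    rw [← neg_neg (∑ z, m z * gam (full V) q H H z), ← sum_mul_lap h.rev H H, ← sum_neg_distrib,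
      mul_sum]
    refine sum_le_sum fun z _ => ?_
    have hm := h.m_pos hδ z
    have e1 : H z * (-lap (full V) q H z) ≤ H z * (4 * D * B ^ 2 * ε) :=
      mul_le_mul_of_nonneg_left (by linarith [hlapH z]) (hH0 z)
    have e2 : H z * (4 * D * B ^ 2 * ε) ≤ 2 * D * B * B * (4 * D * B ^ 2 * ε) :=
      mul_le_mul_of_nonneg_right (hH1 z) (by positivity)
    have e3 := mul_le_mul_of_nonneg_left (e1.trans e2) hm.le
    linarith
  refine (h.osc H x y).trans (mul_le_mul_of_nonneg_left ?_ hc)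
  calc ∑ z, gam (full V) q H H z ≤ ∑ z, δ * (m z * gam (full V) q H H z) := by
        refine sum_le_sum fun z _ => ?_
        have h1 : 1 ≤ δ * m z := by
          have := mul_le_mul_of_nonneg_left (h.le_m z) hδ.le
          rwa [mul_inv_cancel₀ hδ.ne'] at this
        have := mul_le_mul_of_nonneg_right h1 (gam_self_nonneg (N := full V) h.nonneg H z)
        linarith
    _ ≤ _ := by
      rw [← mul_sum]
      exact mul_le_mul_of_nonneg_left h3 hδ.le

end Regular

namespace EigenFrame

variable {f : Fin d → V → ℝ} {μ : Fin d → ℝ}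

theorem abs_le (hf : EigenFrame q m K ε f μ) (h : Regular q m d D δ K c) (hδ : 1 ≤ δ) (i : Fin d)
    (x : V) : |f i x| ≤ δ := by
  have hδ0 : 0 < δ := by linarith
  have h1 : m x * (f i x * f i x) ≤ 1 := by
    have := hf.orth i i
    rw [if_pos rfl] at this
    rw [← this]
    exact single_le_sum (f := fun x => m x * (f i x * f i x))
      (fun y _ => mul_nonneg (h.m_pos hδ0 y).le (mul_self_nonneg _)) (mem_univ x)
  have h2 : δ⁻¹ * (f i x * f i x) ≤ 1 :=
    (mul_le_mul_of_nonneg_right (h.le_m x) (mul_self_nonneg _)).trans h1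
  rw [inv_mul_le_iff₀ hδ0] at h2
  refine abs_le_of_sq_le_sq ?_ hδ0.le
  nlinarith

/-- The constant in `EigenFrame.abs_gam_sub_le`. -/
noncomputable def gramOscConst (n : ℕ) (D δ c : ℝ) : ℝ :=
  Real.sqrt (c * (δ * (8 * D ^ 2 * (2 * δ) ^ 4 * (δ * n))))

/-- A sum f_i + f_j is a K-eigenfunction up to O(ε), so the quadratic estimate applies to it;
polarization yields the mixed terms. The energy bound is for a square, hence √ε. -/
theorem abs_gam_sub_le (hf : EigenFrame q m K ε f μ) (h : Regular q m d D δ K c) (hδ : 1 ≤ δ)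
    (hc : 0 ≤ c) (hε : 0 ≤ ε) (i j : Fin d) (x y : V) :
    |gam (full V) q (f i) (f j) x - gam (full V) q (f i) (f j) y| ≤
      gramOscConst (Fintype.card V) D δ c * Real.sqrt ε := by
  have hδ0 : 0 < δ := by linarith
  have key : ∀ i j, |gam (full V) q (f i + f j) (f i + f j) x -
      gam (full V) q (f i + f j) (f i + f j) y| ≤
      gramOscConst (Fintype.card V) D δ c * Real.sqrt ε := by
    intro i j
    rw [gramOscConst, ← Real.sqrt_mul' _ hε]
    refine Real.abs_le_sqrt ?_
    have h1 := h.gam_sub_sq_le hδ0 hc hε (g := f i + f j) (B := 2 * δ)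
      (r := fun x => (μ i - K) * f i x + (μ j - K) * f j x) ?_ ?_ ?_ x y
    · refine h1.trans ?_
      rw [mul_assoc c, mul_assoc δ]
      refine mul_le_mul_of_nonneg_left (mul_le_mul_of_nonneg_left ?_ hδ0.le) hc
      calc 8 * D ^ 2 * (2 * δ) ^ 4 * ε * ∑ z, m z
          ≤ 8 * D ^ 2 * (2 * δ) ^ 4 * ε * (δ * Fintype.card V) :=
            mul_le_mul_of_nonneg_left h.sum_m_le (by positivity)
        _ = _ := by ring
    · intro z
      have := abs_add_le (f i z) (f j z)
      simp only [Pi.add_apply]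
      linarith [hf.abs_le h hδ i z, hf.abs_le h hδ j z]
    · intro z
      have hterm : ∀ i, |(μ i - K) * f i z| ≤ ε * δ := by
        intro i
        rw [abs_mul, abs_of_nonneg (by linarith [hf.le_mu i])]
        exact mul_le_mul (by linarith [hf.mu_le i]) (hf.abs_le h hδ i z) (abs_nonneg _) hε
      have := abs_add_le ((μ i - K) * f i z) ((μ j - K) * f j z)
      have := hterm i
      have := hterm j
      nlinarith
    · rw [lap_add]
      funext z
      simp only [Pi.add_apply, hf.eig, Pi.sub_apply, Pi.neg_apply, Pi.smul_apply, smul_eq_mul]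
      ring
  -- Polarization: the case i = j controls Γ(2f_i) = 4Γ(f_i).
  have kij := key i j
  have ki := key i i
  have kj := key j j
  simp only [gam_add_left, gam_add_right, Pi.add_apply, gam_comm (f j) (f i)] at kij ki kj
  rw [_root_.abs_le] at *
  constructor <;> linarith

/-- The constant in `EigenFrame.abs_scaled_gam_sub_le`. -/
noncomputable def gramConst (n : ℕ) (D δ K c : ℝ) : ℝ :=
  δ * n / K * gramOscConst n D δ c + 1 / K

theorem gramConst_nonneg (n : ℕ) (D c : ℝ) (hδ : 0 ≤ δ) (hK : 0 ≤ K) :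
    0 ≤ gramConst n D δ K c := by
  unfold gramConst gramOscConst; positivity

/-- By Green's formula Γ(f_i, f_j) has integral μ_i δ_ij. Being almost constant, it is close to its
mean, and μ_i is close to K. -/
theorem abs_scaled_gam_sub_le (hf : EigenFrame q m K ε f μ) (h : Regular q m d D δ K c)
    (hδ : 1 ≤ δ) (hc : 0 ≤ c) (hK : 0 < K) (hε : 0 ≤ ε) (hε1 : ε ≤ 1) (i j : Fin d) (x : V) :
    |(∑ z, m z) / K * gam (full V) q (f i) (f j) x - if i = j then 1 else 0| ≤
      gramConst (Fintype.card V) D δ K c * Real.sqrt ε := by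
  have hδ0 : 0 < δ := by linarith
  have hG0 : 0 ≤ gramOscConst (Fintype.card V) D δ c := Real.sqrt_nonneg _
  have hmean : ∑ z, m z * gam (full V) q (f i) (f j) z = μ i * if i = j then 1 else 0 := by
    have := sum_mul_lap h.rev (f i) (f j)
    rw [eq_neg_iff_add_eq_zero, add_comm, ← eq_neg_iff_add_eq_zero] at this
    rw [this, ← hf.orth i j, mul_sum, ← sum_neg_distrib]
    exact sum_congr rfl fun z _ => by rw [hf.eig]; ring
  have hosc : |(∑ z, m z) * gam (full V) q (f i) (f j) x - μ i * if i = j then 1 else 0| ≤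
      (∑ z, m z) * (gramOscConst (Fintype.card V) D δ c * Real.sqrt ε) := by
    rw [← hmean, sum_mul, sum_mul, ← sum_sub_distrib]
    refine (abs_sum_le_sum_abs _ _).trans (sum_le_sum fun z _ => ?_)
    rw [← mul_sub, abs_mul, abs_of_pos (h.m_pos hδ0 z)]
    exact mul_le_mul_of_nonneg_left (hf.abs_gam_sub_le h hδ hc hε i j x z) (h.m_pos hδ0 z).le
  have hosc' : |(∑ z, m z) * gam (full V) q (f i) (f j) x - μ i * if i = j then 1 else 0| ≤
      (δ * Fintype.card V) * (gramOscConst (Fintype.card V) D δ c * Real.sqrt ε) :=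
    hosc.trans (mul_le_mul_of_nonneg_right h.sum_m_le (by positivity))
  have hmu : |(μ i - K) * if i = j then (1 : ℝ) else 0| ≤ Real.sqrt ε := by
    have hs : ε ≤ Real.sqrt ε := Real.le_sqrt_of_sq_le (by nlinarith)
    have : |μ i - K| ≤ ε := by
      rw [abs_of_nonneg (by linarith [hf.le_mu i])]; linarith [hf.mu_le i]
    split_ifs
    · rw [mul_one]; exact this.trans hs
    · simp
  have hsum : |K * ((∑ z, m z) / K * gam (full V) q (f i) (f j) x - if i = j then 1 else 0)| ≤
      (δ * Fintype.card V) * (gramOscConst (Fintype.card V) D δ c * Real.sqrt ε)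
        + Real.sqrt ε := by
    have e : K * ((∑ z, m z) / K * gam (full V) q (f i) (f j) x - if i = j then 1 else 0) =
        ((∑ z, m z) * gam (full V) q (f i) (f j) x - μ i * if i = j then 1 else 0) +
          (μ i - K) * if i = j then 1 else 0 := by
      field_simp
      ring
    rw [e]
    exact (abs_add_le _ _).trans (add_le_add hosc' hmu)
  rw [abs_mul, abs_of_pos hK, ← le_div_iff₀' hK] at hsum
  refine hsum.trans_eq ?_
  unfold gramConst
  field_simp

end EigenFrame

/-- MᵀM and MMᵀ have equal Frobenius norm and equal trace, so their distances to the identities of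
sizes |S| and |ι| differ exactly by |ι| − |S|. With |S| ≤ |ι|, almost orthonormal rows force almost
orthonormal columns; if the rows are exactly orthonormal, |S| = |ι|. -/
theorem sum_sq_gram_sub {ι : Type*} [Fintype ι] [DecidableEq ι] [DecidableEq V] (M : ι → V → ℝ)
    (S : Finset V) (hS : ∀ i y, y ∉ S → M i y = 0) :
    ∑ y, ∑ y', ((∑ i, M i y * M i y') - if y = y' ∧ y ∈ S then (1 : ℝ) else 0) ^ 2
      + ((Fintype.card ι : ℝ) - S.card) =
    ∑ i, ∑ j, ((∑ y, M i y * M j y) - if i = j then (1 : ℝ) else 0) ^ 2 := by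
  have e1 : ∑ y, ∑ y', (∑ i, M i y * M i y') ^ 2 = ∑ i, ∑ j, (∑ y, M i y * M j y) ^ 2 := by
    simp only [sq, sum_mul_sum]
    have l : ∑ y, ∑ y', ∑ i, ∑ j, M i y * M i y' * (M j y * M j y') =
        ∑ i, ∑ j, ∑ y, ∑ y', M i y * M i y' * (M j y * M j y') := by
      calc _ = ∑ y, ∑ i, ∑ j, ∑ y', M i y * M i y' * (M j y * M j y') := by
            refine sum_congr rfl fun y _ => ?_
            rw [sum_comm]
            exact sum_congr rfl fun i _ => sum_comm
        _ = _ := by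
            rw [sum_comm]
            exact sum_congr rfl fun i _ => sum_comm
    rw [l]
    refine sum_congr rfl fun i _ => sum_congr rfl fun j _ => sum_congr rfl fun y _ =>
      sum_congr rfl fun y' _ => ?_
    ring
  have e2 : ∑ y ∈ S, ∑ i, M i y * M i y = ∑ i, ∑ y, M i y * M i y := by
    rw [sum_comm]
    refine sum_congr rfl fun i _ => sum_subset (subset_univ _) fun y _ hy => ?_
    rw [hS i y hy, mul_zero]
  have l1 : ∑ y, ∑ y', ((∑ i, M i y * M i y') - if y = y' ∧ y ∈ S then (1 : ℝ) else 0) ^ 2 =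
      ∑ y, ∑ y', (∑ i, M i y * M i y') ^ 2 - 2 * ∑ y ∈ S, ∑ i, M i y * M i y + S.card := by
    have : ∀ y y', ((∑ i, M i y * M i y') - if y = y' ∧ y ∈ S then (1 : ℝ) else 0) ^ 2 =
        (∑ i, M i y * M i y') ^ 2 + if y = y' then
          (if y ∈ S then (1 - 2 * ∑ i, M i y * M i y) else 0) else 0 := by
      intro y y'
      by_cases hy : y = y'
      · subst hy
        by_cases hm : y ∈ S
        · simp only [hm, and_self, if_true]; ring
        · simp [hm]
      · simp [hy]
    simp only [this, sum_add_distrib, sum_ite_eq, mem_univ, if_true]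
    rw [sum_ite_mem, univ_inter, sum_sub_distrib, ← mul_sum]
    simp
    ring
  have l2 : ∑ i, ∑ j, ((∑ y, M i y * M j y) - if i = j then (1 : ℝ) else 0) ^ 2 =
      ∑ i, ∑ j, (∑ y, M i y * M j y) ^ 2 - 2 * ∑ i, ∑ y, M i y * M i y + Fintype.card ι := by
    have : ∀ i j, ((∑ y, M i y * M j y) - if i = j then (1 : ℝ) else 0) ^ 2 =
        (∑ y, M i y * M j y) ^ 2 + if i = j then (1 - 2 * ∑ y, M i y * M i y) else 0 := by
      intro i j
      by_cases hy : i = j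
      · subst hy; simp only [if_true]; ring
      · simp [hy]
    simp only [this, sum_add_distrib, sum_ite_eq, mem_univ, if_true]
    rw [sum_sub_distrib, ← mul_sum]
    simp
    ring
  rw [l1, l2, e1, e2]
  ring

end GraphKernel

/-! ### Almost Euclidean geometry of the position map -/

namespace GraphKernel

open Finset

variable {V : Type*} [Fintype V]

/-- A position map `P : V → ℝ^d` whose coordinates are eigenfunctions of `-Δ` with eigenvalues in
`[K, K + ε]`, with carré du champ matrix `s`-close to the identity at every vertex. -/
structure Position {d : ℕ} (q : V → V → ℝ) (K ε s B : ℝ) (P : V → Fin d → ℝ)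
    (μ : Fin d → ℝ) : Prop where
  eig : ∀ i x, ∑ y, q x y * (P y i - P x i) = -(μ i * P x i)
  le_mu : ∀ i, K ≤ μ i
  mu_le : ∀ i, μ i ≤ K + ε
  gram : ∀ i j x, |gam (full V) q (fun x => P x i) (fun x => P x j) x - if i = j then 1 else 0| ≤ s
  bound : ∀ i x, |P x i| ≤ B

variable {q : V → V → ℝ} {m : V → ℝ} {d : ℕ} {D δ K c ε s B : ℝ} {P : V → Fin d → ℝ}
  {μ : Fin d → ℝ}

theorem EigenFrame.position {f : Fin d → V → ℝ} (hf : EigenFrame q m K ε f μ)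
    (h : Regular q m d D δ K c) (hδ : 1 ≤ δ) (hc : 0 ≤ c) (hK : 0 < K) (hε : 0 ≤ ε)
    (hε1 : ε ≤ 1) :
    Position q K ε (gramConst (Fintype.card V) D δ K c * Real.sqrt ε)
      (Real.sqrt (δ * Fintype.card V / K) * δ)
      (fun x i => Real.sqrt ((∑ z, m z) / K) * f i x) μ where
  eig i x := by
    have := hf.eig i x
    simp only [lap] at this
    rw [mul_left_comm, ← mul_neg, ← this, mul_sum]
    exact sum_congr rfl fun y _ => by ring
  le_mu := hf.le_mu
  mu_le := hf.mu_le
  gram i j x := by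
    have hm : 0 ≤ (∑ z, m z) / K :=
      div_nonneg (sum_nonneg fun z _ => (h.m_pos (by linarith) z).le) hK.le
    have := hf.abs_scaled_gam_sub_le h hδ hc hK hε hε1 i j x
    have e : gam (full V) q (fun x => Real.sqrt ((∑ z, m z) / K) * f i x)
        (fun x => Real.sqrt ((∑ z, m z) / K) * f j x) x =
        (∑ z, m z) / K * gam (full V) q (f i) (f j) x := by
      change gam (full V) q (Real.sqrt ((∑ z, m z) / K) • f i)
        (Real.sqrt ((∑ z, m z) / K) • f j) x = _
      rw [gam_smul_left, gam_smul_right, Pi.smul_apply, Pi.smul_apply, smul_eq_mul, smul_eq_mul,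
        ← mul_assoc, Real.mul_self_sqrt hm]
    rwa [e]
  bound i x := by
    rw [abs_mul, abs_of_nonneg (Real.sqrt_nonneg _)]
    refine mul_le_mul (Real.sqrt_le_sqrt ?_) (hf.abs_le h hδ i x) (abs_nonneg _)
      (Real.sqrt_nonneg _)
    exact div_le_div_of_nonneg_right h.sum_m_le hK.le

namespace Regular

theorem card_pos_le (h : Regular q m d D δ K c) (x : V) :
    (univ.filter fun y => 0 < q x y).card ≤ d := by
  by_contra hcon
  obtain ⟨y, hy, h0⟩ := h.card_le x _ (not_le.1 hcon)
  exact (mem_filter.1 hy).2.ne' h0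

theorem pos_symm (h : Regular q m d D δ K c) (hδ : 0 < δ) {x y : V} (hxy : 0 < q x y) :
    0 < q y x := by
  have h1 := h.rev x y
  have h2 := mul_pos (h.m_pos hδ x) hxy
  rw [h1] at h2
  exact pos_of_mul_pos_right h2 (h.m_pos hδ y).le

end Regular

namespace Position

variable (h : Regular q m d D δ K c) (hP : Position q K ε s B P μ)
include h hP

/-- Gram duality for the matrix with columns √(q(x,y)/2)(P y − P x), whose row Gram matrix is Γ(P_i,
P_j)(x). -/
theorem sum_sq_gram_le [DecidableEq V] (x : V) :
    ∑ y, ∑ y', ((1 / 2 * (Real.sqrt (q x y) * Real.sqrt (q x y')) *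
        ((P y - P x) ⬝ᵥ (P y' - P x))) - if y = y' ∧ 0 < q x y then (1 : ℝ) else 0) ^ 2
      + ((d : ℝ) - (univ.filter fun y => 0 < q x y).card) ≤ (d * s) ^ 2 := by
  have key := sum_sq_gram_sub (fun (i : Fin d) y => Real.sqrt (q x y / 2) * (P y i - P x i))
    (univ.filter fun y => 0 < q x y) (by
      intro i y hy
      have : q x y = 0 := le_antisymm (by simpa using hy) (h.nonneg x y)
      simp [this])
  have e1 : ∀ y y', ∑ i, Real.sqrt (q x y / 2) * (P y i - P x i) *
      (Real.sqrt (q x y' / 2) * (P y' i - P x i)) =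
      1 / 2 * (Real.sqrt (q x y) * Real.sqrt (q x y')) * ((P y - P x) ⬝ᵥ (P y' - P x)) := by
    intro y y'
    rw [dotProduct, mul_sum]
    refine sum_congr rfl fun i _ => ?_
    rw [Real.sqrt_div (h.nonneg _ _), Real.sqrt_div (h.nonneg _ _), Pi.sub_apply, Pi.sub_apply]
    have h2 : Real.sqrt 2 * Real.sqrt 2 = 2 := Real.mul_self_sqrt (by norm_num)
    have h3 : Real.sqrt 2 ≠ 0 := by positivity
    field_simp
    linear_combination -(P y i - P x i) * (P y' i - P x i) * (Real.sqrt (q x y) * Real.sqrt (q x y')) * h2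
  have e2 : ∀ i j, ∑ y, Real.sqrt (q x y / 2) * (P y i - P x i) *
      (Real.sqrt (q x y / 2) * (P y j - P x j)) =
      gam (full V) q (fun x => P x i) (fun x => P x j) x := by
    intro i j
    rw [gam, mul_sum]
    refine sum_congr rfl fun y _ => ?_
    have : Real.sqrt (q x y / 2) * Real.sqrt (q x y / 2) = q x y / 2 :=
      Real.mul_self_sqrt (by have := h.nonneg x y; positivity)
    linear_combination (P y i - P x i) * (P y j - P x j) * this
  simp only [e1, e2, mem_filter, mem_univ, true_and, Fintype.card_fin] at key
  rw [key]
  calc _ ≤ ∑ _i : Fin d, ∑ _j : Fin d, s ^ 2 := by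
        refine sum_le_sum fun i _ => sum_le_sum fun j _ => ?_
        exact sq_le_sq' (abs_le.1 (hP.gram i j x)).1 (abs_le.1 (hP.gram i j x)).2
    _ = _ := by simp; ring

theorem mul_s_nonneg (x : V) : 0 ≤ (d : ℝ) * s := by
  rcases Nat.eq_zero_or_pos d with hd | hd
  · subst hd; simp
  · have := (abs_nonneg _).trans (hP.gram ⟨0, hd⟩ ⟨0, hd⟩ x)
    positivity

theorem abs_gram_entry_le [DecidableEq V] (x y y' : V) :
    |(1 / 2 * (Real.sqrt (q x y) * Real.sqrt (q x y')) *
        ((P y - P x) ⬝ᵥ (P y' - P x))) - if y = y' ∧ 0 < q x y then (1 : ℝ) else 0| ≤ d * s := by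
  refine abs_le_of_sq_le_sq ?_ (hP.mul_s_nonneg h x)
  have hc : ((univ.filter fun y => 0 < q x y).card : ℝ) ≤ d := by exact_mod_cast h.card_pos_le x
  refine le_trans ?_ ((le_add_of_nonneg_right (by linarith)).trans (hP.sum_sq_gram_le h x))
  refine le_trans ?_ (single_le_sum (fun _ _ => sum_nonneg fun _ _ => sq_nonneg _) (mem_univ y))
  exact single_le_sum (f := fun y' => ((1 / 2 * (Real.sqrt (q x y) * Real.sqrt (q x y')) *
        ((P y - P x) ⬝ᵥ (P y' - P x))) - if y = y' ∧ 0 < q x y then (1 : ℝ) else 0) ^ 2)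
    (fun _ _ => sq_nonneg _) (mem_univ y')

theorem abs_norm_sub_le {x y : V} (hxy : 0 < q x y) :
    |1 / 2 * q x y * ((P y - P x) ⬝ᵥ (P y - P x)) - 1| ≤ d * s := by
  classical
  have := hP.abs_gram_entry_le h x y y
  rwa [if_pos ⟨rfl, hxy⟩, Real.mul_self_sqrt (h.nonneg x y)] at this

theorem abs_inner_le {x y y' : V} (hyy : y ≠ y') :
    |1 / 2 * (Real.sqrt (q x y) * Real.sqrt (q x y')) * ((P y - P x) ⬝ᵥ (P y' - P x))| ≤
      d * s := by
  classical
  have := hP.abs_gram_entry_le h x y y'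
  rwa [if_neg (fun hc => hyy hc.1), sub_zero] at this

/-- The constant in `Position.abs_radial_le`. -/
noncomputable def radialError (n d : ℕ) (D q₀ B s ε : ℝ) : ℝ :=
  2 * (d * s) + n * (2 * Real.sqrt D / Real.sqrt q₀ * (d * s)) + d * (2 * B ^ 2 * ε)

/-- Pair Σ q(x,y')(P y' − P x) = −μ P x, read coordinatewise, with P y − P x. By almost
orthogonality only y' = y survives, contributing about 2. The bound q₀ is needed to divide by
√q(x,y). -/
theorem abs_radial_le {q₀ : ℝ} (hq₀ : 0 < q₀) {x y : V} (hxy : q₀ ≤ q x y) :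
    |K * (P x ⬝ᵥ (P y - P x)) + 2| ≤ radialError (Fintype.card V) d D q₀ B s ε := by
  classical
  have hxy0 := hq₀.trans_le hxy
  have hds := hP.mul_s_nonneg h x
  have hsum : ∑ y', q x y' * ((P y - P x) ⬝ᵥ (P y' - P x)) =
      -∑ i, μ i * (P x i * (P y i - P x i)) := by
    simp only [dotProduct, Pi.sub_apply, mul_sum]
    rw [sum_comm, ← sum_neg_distrib]
    refine sum_congr rfl fun i _ => ?_
    have := hP.eig i x
    calc ∑ y', q x y' * ((P y i - P x i) * (P y' i - P x i)) =
        (P y i - P x i) * ∑ y', q x y' * (P y' i - P x i) := by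
          rw [mul_sum]; exact sum_congr rfl fun _ _ => by ring
      _ = _ := by rw [this]; ring
  have hsplit := add_sum_erase univ (fun y' => q x y' * ((P y - P x) ⬝ᵥ (P y' - P x))) (mem_univ y)
  have hrest : |∑ y' ∈ univ.erase y, q x y' * ((P y - P x) ⬝ᵥ (P y' - P x))| ≤
      Fintype.card V * (2 * Real.sqrt D / Real.sqrt q₀ * (d * s)) := by
    refine (abs_sum_le_sum_abs _ _).trans ?_
    have hterm : ∀ y' ∈ univ.erase y, |q x y' * ((P y - P x) ⬝ᵥ (P y' - P x))| ≤
        2 * Real.sqrt D / Real.sqrt q₀ * (d * s) := by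
      intro y' hy'
      have h1 := hP.abs_inner_le h (x := x) (ne_of_mem_erase hy').symm
      have hsq : 0 < Real.sqrt (q x y) := Real.sqrt_pos.2 hxy0
      have e : q x y' * ((P y - P x) ⬝ᵥ (P y' - P x)) = 2 * Real.sqrt (q x y') / Real.sqrt (q x y) *
          (1 / 2 * (Real.sqrt (q x y) * Real.sqrt (q x y')) *
            ((P y - P x) ⬝ᵥ (P y' - P x))) := by
        have := Real.mul_self_sqrt (h.nonneg x y')
        field_simp
        rw [sq, this]
        ring
      rw [e, abs_mul, abs_of_nonneg (by positivity)]
      refine mul_le_mul ?_ h1 (abs_nonneg _) (by positivity)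
      refine div_le_div₀ (by positivity) ?_ (Real.sqrt_pos.2 hq₀) (Real.sqrt_le_sqrt hxy)
      exact mul_le_mul_of_nonneg_left (Real.sqrt_le_sqrt (h.q_le x y')) (by norm_num)
    refine (sum_le_sum hterm).trans ?_
    rw [sum_const, nsmul_eq_mul]
    refine mul_le_mul_of_nonneg_right ?_ (by positivity)
    exact_mod_cast card_le_univ _
  have hmu : |∑ i, (μ i - K) * (P x i * (P y i - P x i))| ≤ d * (2 * B ^ 2 * ε) := by
    refine (abs_sum_le_sum_abs _ _).trans ?_
    have hterm : ∀ i ∈ (univ : Finset (Fin d)), |(μ i - K) * (P x i * (P y i - P x i))| ≤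
        2 * B ^ 2 * ε := by
      intro i _
      have h1 := hP.bound i x
      have h2 := hP.bound i y
      have h3 := abs_sub (P y i) (P x i)
      have hB : 0 ≤ B := (abs_nonneg _).trans h1
      rw [abs_mul, abs_mul, abs_of_nonneg (by linarith [hP.le_mu i])]
      have h4 : |P x i| * |P y i - P x i| ≤ B * (2 * B) :=
        mul_le_mul h1 (by linarith) (abs_nonneg _) hB
      have h5 : (μ i - K) * (|P x i| * |P y i - P x i|) ≤ ε * (B * (2 * B)) :=
        mul_le_mul (by linarith [hP.mu_le i]) h4 (by positivity)
          (by linarith [hP.mu_le i, hP.le_mu i])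
      linarith
    refine (sum_le_sum hterm).trans_eq ?_
    simp
  have hself := hP.abs_norm_sub_le h hxy0
  have hK : ∑ i, μ i * (P x i * (P y i - P x i)) =
      K * (P x ⬝ᵥ (P y - P x)) + ∑ i, (μ i - K) * (P x i * (P y i - P x i)) := by
    rw [dotProduct, mul_sum, ← sum_add_distrib]
    exact sum_congr rfl fun i _ => by rw [Pi.sub_apply]; ring
  unfold radialError
  rw [abs_le] at *
  constructor <;> linarith

/-- Add the radial identities at the two ends of the edge. -/
theorem abs_norm_sq_le {q₀ : ℝ} (hq₀ : 0 < q₀) {x y : V} (hxy : q₀ ≤ q x y) (hyx : q₀ ≤ q y x) :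
    |K * ((P y - P x) ⬝ᵥ (P y - P x)) - 4| ≤
      2 * radialError (Fintype.card V) d D q₀ B s ε := by
  have h1 := hP.abs_radial_le h hq₀ hxy
  have h2 := hP.abs_radial_le h hq₀ hyx
  have e : K * ((P y - P x) ⬝ᵥ (P y - P x)) =
      -(K * (P y ⬝ᵥ (P x - P y))) - K * (P x ⬝ᵥ (P y - P x)) := by
    simp only [dotProduct_sub, sub_dotProduct]; ring
  rw [e]
  rw [abs_le] at *
  constructor <;> linarith

/-- The error in `Position.abs_q_sub_le`. -/
noncomputable def rateError (n d : ℕ) (D K q₀ B s ε : ℝ) : ℝ :=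
  (K * (d * s) + D * radialError n d D q₀ B s ε) / 2

/-- Combine ½ q|P y − P x|² ≈ 1 with K|P y − P x|² ≈ 4. -/
theorem abs_q_sub_le (hK : 0 ≤ K) {q₀ : ℝ} (hq₀ : 0 < q₀) {x y : V} (hxy : q₀ ≤ q x y)
    (hyx : q₀ ≤ q y x) :
    |q x y - K / 2| ≤ rateError (Fintype.card V) d D K q₀ B s ε := by
  have h1 := hP.abs_norm_sub_le h (hq₀.trans_le hxy)
  have h2 := hP.abs_norm_sq_le h hq₀ hxy hyx
  set n := (P y - P x) ⬝ᵥ (P y - P x)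
  have h3 : |K * (1 / 2 * q x y * n - 1)| ≤ K * (d * s) := by
    rw [abs_mul, abs_of_nonneg hK]; exact mul_le_mul_of_nonneg_left h1 hK
  have h4 : |q x y * (K * n - 4)| ≤ D * (2 * radialError (Fintype.card V) d D q₀ B s ε) := by
    rw [abs_mul, abs_of_nonneg (h.nonneg x y)]
    exact mul_le_mul (h.q_le x y) h2 (abs_nonneg _) (h.D_nonneg x)
  unfold rateError
  rw [abs_le] at *
  constructor <;> nlinarith

end Position

end GraphKernel

/-! ### Rigidity: the equality case is the hypercube -/

namespace GraphKernel

open Finset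

section Involutions

variable {V : Type*} {d : ℕ} {τ : Fin d → V → V} {b : V → Fin d → Bool}

theorem flip_foldr_apply (hb : ∀ i x, b (τ i x) = Function.update (b x) i (!b x i))
    {l : List (Fin d)} (hl : l.Nodup) (x : V) (j : Fin d) :
    b (l.foldr τ x) j = if j ∈ l then !b x j else b x j := by
  induction l with
  | nil => simp
  | cons a l ih =>
    rw [List.nodup_cons] at hl
    rw [List.foldr_cons, hb]
    by_cases hj : j = a
    · subst hj
      simp [ih hl.2, hl.1]
    · simp [hj, ih hl.2]

/-- Commuting involutions: repeated letters of a path cancel. -/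
theorem exists_foldr_eq (hinv : ∀ i x, τ i (τ i x) = x)
    (hcomm : ∀ i j x, τ i (τ j x) = τ j (τ i x)) {x y : V}
    (hxy : Relation.ReflTransGen (fun x y => ∃ i, y = τ i x) x y) :
    ∃ l : List (Fin d), l.Nodup ∧ y = l.foldr τ x := by
  classical
  have : LeftCommutative τ := ⟨hcomm⟩
  induction hxy with
  | refl => exact ⟨[], List.nodup_nil, rfl⟩
  | @tail y z _ hz ih =>
    obtain ⟨l, hl, rfl⟩ := ih
    obtain ⟨i, rfl⟩ := hz
    by_cases hi : i ∈ l
    · refine ⟨l.erase i, hl.erase i, ?_⟩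
      rw [(List.perm_cons_erase hi).foldr_eq x, List.foldr_cons, hinv]
    · exact ⟨i :: l, List.nodup_cons.2 ⟨hi, hl⟩, rfl⟩

/-- A repetition-free word flips exactly the coordinates it contains. So only the empty word
preserves b, and every bit string is reached. -/
theorem bijective_of_flip [Nonempty V] (hinv : ∀ i x, τ i (τ i x) = x)
    (hcomm : ∀ i j x, τ i (τ j x) = τ j (τ i x))
    (hconn : ∀ x y, Relation.ReflTransGen (fun x y => ∃ i, y = τ i x) x y)
    (hb : ∀ i x, b (τ i x) = Function.update (b x) i (!b x i)) : Function.Bijective b := by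
  constructor
  · intro x y hxy
    obtain ⟨l, hl, rfl⟩ := exists_foldr_eq hinv hcomm (hconn x y)
    have : l = [] := by
      rw [List.eq_nil_iff_forall_not_mem]
      intro j hj
      have := congrFun hxy j
      rw [flip_foldr_apply hb hl, if_pos hj] at this
      simp at this
    rw [this]; rfl
  · intro s
    obtain ⟨x⟩ := ‹Nonempty V›
    refine ⟨((List.finRange d).filter fun i => s i ≠ b x i).foldr τ x, ?_⟩
    funext j
    rw [flip_foldr_apply hb ((List.nodup_finRange d).filter _)]
    by_cases hj : s j = b x j
    · simp [hj]
    · have : s j = !b x j := by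
        cases h1 : s j <;> cases h2 : b x j <;> simp_all
      simp [this]

end Involutions

theorem hypercubeGraph_adj_iff {d : ℕ} {x y : Fin d → Bool} :
    (hypercubeGraph d).Adj x y ↔ ∃ i, y = Function.update x i (!x i) := by
  constructor
  · rintro ⟨i, hi, hu⟩
    refine ⟨i, funext fun j => ?_⟩
    by_cases hj : j = i
    · subst hj
      rw [Function.update_self]
      cases h1 : x j <;> cases h2 : y j <;> simp_all
    · rw [Function.update_of_ne hj]
      by_contra hne
      exact hj (hu j fun h => hne h.symm)
  · rintro ⟨i, rfl⟩
    refine ⟨i, by simp, fun j hj => ?_⟩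
    by_contra hne
    simp [hne] at hj

variable {V : Type*} {q : V → V → ℝ} {m : V → ℝ} {d : ℕ} {D δ K c B : ℝ}
  {P : V → Fin d → ℝ} {μ : Fin d → ℝ}

/-- Γ₂ − KΓ at x is a positive semidefinite form, so an isotropic vector lies in its kernel. -/
theorem CD.gam2_eq_of_equality {N : V → Finset V} (hCD : CD N q K) {g : V → ℝ} {x : V}
    (hg : gam2 N q g g x = K * gam N q g g x) (k : V → ℝ) :
    gam2 N q g k x = K * gam N q g k x := by
  have key : ∀ t : ℝ, 0 ≤ (gam2 N q k k x - K * gam N q k k x) * (t * t) +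
      2 * (gam2 N q g k x - K * gam N q g k x) * t + 0 := by
    intro t
    have h1 := hCD (g + t • k) x
    have e1 : gam N q (g + t • k) (g + t • k) =
        gam N q g g + (2 * t) • gam N q g k + (t * t) • gam N q k k := by
      simp only [gam_add_left, gam_add_right, gam_smul_left, gam_smul_right, gam_comm k g]
      funext y; simp; ring
    have e2 : gam2 N q (g + t • k) (g + t • k) x =
        gam2 N q g g x + 2 * t * gam2 N q g k x + t * t * gam2 N q k k x := by
      unfold gam2
      rw [e1]
      simp only [lap_add, lap_smul, gam_add_left, gam_add_right, gam_smul_left, gam_smul_right,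
        Pi.add_apply, Pi.smul_apply, smul_eq_mul]
      ring
    rw [e2, e1, hg] at h1
    simp only [Pi.add_apply, Pi.smul_apply, smul_eq_mul] at h1
    linarith
  have := discrim_le_zero key
  simp only [discrim, mul_zero, sub_zero] at this
  have h2 : 2 * (gam2 N q g k x - K * gam N q g k x) = 0 := by
    have := le_antisymm this (sq_nonneg _)
    exact pow_eq_zero_iff (two_ne_zero) |>.1 this
  linarith

variable [Fintype V]

theorem gam2_single [DecidableEq V] (g : V → ℝ) {x z : V} (hxz : x ≠ z) (hq : q x z = 0) :
    gam2 (full V) q g (Pi.single z 1) x = 1 / 4 * ∑ y, q x y * q y z * (g z - 2 * g y + g x) := by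
  have h1 : ∀ u : V → ℝ, gam (full V) q (Pi.single z 1) u x = 0 := by
    intro u
    rw [gam, sum_eq_zero, mul_zero]
    intro y _
    by_cases hy : y = z
    · subst hy; rw [hq, zero_mul]
    · simp [hy, hxz]
  have h2 : ∀ y, y ≠ z → gam (full V) q g (Pi.single z 1) y = 1 / 2 * (q y z * (g z - g y)) := by
    intro y hy
    rw [gam, sum_eq_single z]
    · simp [hy]
    · intro u _ hu; simp [hu, hy]
    · simp
  have h3 : ∀ y, y ≠ z → lap (full V) q (Pi.single z 1) y = q y z := by
    intro y hy
    rw [lap, sum_eq_single z]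
    · simp [hy]
    · intro u _ hu; simp [hu, hy]
    · simp
  have h4 : gam (full V) q g (Pi.single z 1) x = 0 := by rw [gam_comm, h1]
  rw [gam2, h1, sub_zero, gam, h3 x hxz, hq, lap, h4, mul_sum, ← sum_sub_distrib, mul_sum, mul_sum]
  refine sum_congr rfl fun y _ => ?_
  by_cases hy : y = z
  · subst hy; rw [hq]; ring
  · rw [h2 y hy, h3 y hy]; ring

/-- The indicator of a component has Γ = 0, so the Poincaré inequality makes it constant. -/
theorem Regular.reflTransGen (h : Regular q m d D δ K c) (hδ : 0 < δ) (x y : V) :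
    Relation.ReflTransGen (fun x y => 0 < q x y) x y := by
  classical
  set f : V → ℝ := fun z => if Relation.ReflTransGen (fun x y => 0 < q x y) x z then 1 else 0
    with hf
  have hgam : ∀ z, gam (full V) q f f z = 0 := by
    intro z
    rw [gam, sum_eq_zero, mul_zero]
    intro u _
    by_cases hzu : 0 < q z u
    · have : f u = f z := by
        have : Relation.ReflTransGen (fun x y => 0 < q x y) x u ↔
            Relation.ReflTransGen (fun x y => 0 < q x y) x z :=
          ⟨fun hu => hu.tail (h.pos_symm hδ hzu), fun hz => hz.tail hzu⟩
        simp only [hf, this]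
      rw [this]; ring
    · rw [le_antisymm (not_lt.1 hzu) (h.nonneg _ _), zero_mul]
  have h1 := h.osc f x y
  simp only [hgam, sum_const_zero, mul_zero] at h1
  by_contra hcon
  simp [hf, hcon, Relation.ReflTransGen.refl] at h1
  norm_num at h1

namespace Position

variable (h : Regular q m d D δ K c) (hP : Position q K 0 0 B P μ) (hδ : 0 < δ) (hK : 0 < K)
include h hP

theorem inner_eq_zero {x y y' : V} (hy : 0 < q x y) (hy' : 0 < q x y') (hne : y ≠ y') :
    (P y - P x) ⬝ᵥ (P y' - P x) = 0 := by
  have := hP.abs_inner_le h (x := x) hne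
  rw [mul_zero] at this
  have := abs_nonpos_iff.1 this
  have h1 := Real.sqrt_pos.2 hy
  have h2 := Real.sqrt_pos.2 hy'
  exact (mul_eq_zero.1 this).resolve_left (by positivity)

theorem card_eq (x : V) : (univ.filter fun y => 0 < q x y).card = d := by
  classical
  refine le_antisymm (h.card_pos_le x) ?_
  have := hP.sum_sq_gram_le h x
  rw [mul_zero, zero_pow two_ne_zero] at this
  have h2 : 0 ≤ ∑ y, ∑ y', ((1 / 2 * (Real.sqrt (q x y) * Real.sqrt (q x y')) *
        ((P y - P x) ⬝ᵥ (P y' - P x))) - if y = y' ∧ 0 < q x y then (1 : ℝ) else 0) ^ 2 :=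
    sum_nonneg fun _ _ => sum_nonneg fun _ _ => sq_nonneg _
  have h3 : (d : ℝ) ≤ (univ.filter fun y => 0 < q x y).card := by linarith
  exact_mod_cast h3

theorem radial_eq {x y : V} (hy : 0 < q x y) : K * (P x ⬝ᵥ (P y - P x)) = -2 := by
  have := hP.abs_radial_le h hy le_rfl
  simp only [radialError, mul_zero, add_zero] at this
  linarith [abs_nonpos_iff.1 this]

/-- Each coordinate has Γ = 1 and eigenvalue K, hence gives equality in CD at x. Testing the kernel
condition with the indicator of z isolates the common neighbours of x and z. -/
theorem sum_common_eq_zero {x z : V} (hxz : x ≠ z) (hq : q x z = 0) (i : Fin d) :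
    ∑ y, q x y * q y z * (P z i - 2 * P y i + P x i) = 0 := by
  classical
  have hmu : μ i = K := le_antisymm (by linarith [hP.mu_le i]) (hP.le_mu i)
  set g : V → ℝ := fun x => P x i with hg
  have hlap : lap (full V) q g = (-K) • g := by
    funext y
    have := hP.eig i y
    rw [hmu] at this
    simpa [lap, hg] using this
  have hgam : ∀ y, gam (full V) q g g y = 1 := fun y => by
    have := hP.gram i i y
    rw [if_pos rfl] at this
    linarith [abs_nonpos_iff.1 this]
  have heq : gam2 (full V) q g g x = K * gam (full V) q g g x := by
    rw [gam2, hlap, gam_smul_right, lap]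
    simp [hgam]
    ring
  have h1 := h.cd.gam2_eq_of_equality heq (Pi.single z 1)
  rw [gam2_single g hxz hq] at h1
  have h2 : gam (full V) q g (Pi.single z 1) x = 0 := by
    rw [gam, sum_eq_zero, mul_zero]
    intro y _
    by_cases hy : y = z
    · subst hy; rw [hq, zero_mul]
    · simp [hy, hxz]
  rw [h2, mul_zero] at h1
  linarith

include hδ

theorem norm_eq {x y : V} (hy : 0 < q x y) : K * ((P y - P x) ⬝ᵥ (P y - P x)) = 4 := by
  have := hP.abs_norm_sq_le h (lt_min hy (h.pos_symm hδ hy)) (min_le_left _ _) (min_le_right _ _)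
  simp only [radialError, mul_zero, add_zero] at this
  linarith [abs_nonpos_iff.1 this]

/-- A triangle would have right angles at both x and y, forcing |P y − P x| = 0. -/
theorem not_adj {x y y' : V} (hy : 0 < q x y) (hy' : 0 < q x y') (hne : y ≠ y') : q y y' = 0 := by
  refine le_antisymm (not_lt.1 fun hcon => ?_) (h.nonneg _ _)
  have hxy' : x ≠ y' := by
    rintro rfl; rw [h.diag] at hy'; exact lt_irrefl _ hy'
  have h1 := hP.inner_eq_zero h (h.pos_symm hδ hy) hcon hxy'
  have h2 := hP.inner_eq_zero h hy hy' hne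
  have h3 := hP.norm_eq h hδ hy
  simp only [dotProduct_sub, sub_dotProduct] at h1 h2 h3
  rw [dotProduct_comm (P y) (P x)] at *
  have h4 : P y ⬝ᵥ P y - P x ⬝ᵥ P y - (P x ⬝ᵥ P y - P x ⬝ᵥ P x) = 0 := by linarith
  rw [h4] at h3
  norm_num at h3

include hK

theorem q_eq {x y : V} (hy : 0 < q x y) : q x y = K / 2 := by
  have := hP.abs_q_sub_le h hK.le (lt_min hy (h.pos_symm hδ hy)) (min_le_left _ _)
    (min_le_right _ _)
  simp only [rateError, radialError, mul_zero, add_zero, zero_div] at this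
  linarith [abs_nonpos_iff.1 this]

theorem normSq_eq {x y : V} (hy : 0 < q x y) : P y ⬝ᵥ P y = P x ⬝ᵥ P x := by
  have h1 := hP.radial_eq h hy
  have h2 := hP.norm_eq h hδ hy
  simp only [dotProduct_sub, sub_dotProduct] at h1 h2
  rw [dotProduct_comm (P y) (P x)] at h2
  have : K * (P y ⬝ᵥ P y - P x ⬝ᵥ P x) = 0 := by linarith
  have := (mul_eq_zero.1 this).resolve_left hK.ne'
  linarith

/-- Let k be the number of common neighbours and u = P z − P x, so k u = 2 Σ (P y − P x). The radial
identity and |P z| = |P x| give K|u|² = 8; orthogonality gives K|k u|² = 16k. Hence k = 2. -/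
theorem exists_opposite {x y z : V} (hxz : x ≠ z) (hq : q x z = 0) (hxy : 0 < q x y)
    (hyz : 0 < q y z) :
    ∃ y', 0 < q x y' ∧ 0 < q y' z ∧ P z - P x = (P y - P x) + (P y' - P x) := by
  classical
  set S : Finset V := univ.filter fun y => 0 < q x y ∧ 0 < q y z with hS
  have hyS : y ∈ S := by simp [hS, hxy, hyz]
  set u := P z - P x with hu
  have hvec : (S.card : ℝ) • u = (2 : ℝ) • ∑ y ∈ S, (P y - P x) := by
    funext i
    have h1 := hP.sum_common_eq_zero h hxz hq i
    have h2 : ∑ y ∈ S, (K / 2 * (K / 2)) * (P z i - 2 * P y i + P x i) = 0 := by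
      rw [← h1]
      rw [← sum_subset (subset_univ S)]
      · refine sum_congr rfl fun y hy => ?_
        have := (mem_filter.1 hy).2
        rw [hP.q_eq h hδ hK this.1, hP.q_eq h hδ hK this.2]
      · intro y _ hy
        by_cases h3 : 0 < q x y
        · have h4 : q y z = 0 := le_antisymm
            (not_lt.1 fun h4 => hy (mem_filter.2 ⟨mem_univ _, h3, h4⟩)) (h.nonneg _ _)
          rw [h4]; ring
        · rw [le_antisymm (not_lt.1 h3) (h.nonneg _ _)]; ring
    rw [← mul_sum] at h2
    have h3 := (mul_eq_zero.1 h2).resolve_left (by positivity)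
    have h4 : ∑ y ∈ S, (P z i - 2 * P y i + P x i) =
        S.card * (P z i - P x i) - 2 * ∑ y ∈ S, (P y i - P x i) := by
      rw [mul_sum, ← nsmul_eq_mul, ← sum_const, ← sum_sub_distrib]
      exact sum_congr rfl fun _ _ => by ring
    rw [h4] at h3
    simp only [hu, Pi.smul_apply, Finset.sum_apply, Pi.sub_apply, smul_eq_mul]
    linarith
  have hk : 0 < (S.card : ℝ) := by exact_mod_cast card_pos.2 ⟨y, hyS⟩
  have hrad : K * (P x ⬝ᵥ u) = -4 := by
    have h1 : (S.card : ℝ) * (K * (P x ⬝ᵥ u)) = S.card * (-4) := by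
      calc (S.card : ℝ) * (K * (P x ⬝ᵥ u)) = K * (P x ⬝ᵥ ((S.card : ℝ) • u)) := by
            rw [dotProduct_smul, smul_eq_mul]; ring
        _ = 2 * ∑ y ∈ S, K * (P x ⬝ᵥ (P y - P x)) := by
            rw [hvec, dotProduct_smul, dotProduct_sum, ← mul_sum, smul_eq_mul]; ring
        _ = 2 * ∑ y ∈ S, (-2 : ℝ) := by
            congr 1
            exact sum_congr rfl fun y hy => hP.radial_eq h (mem_filter.1 hy).2.1
        _ = _ := by rw [sum_const, nsmul_eq_mul]; ring
    exact mul_left_cancel₀ hk.ne' h1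
  have hnorm : K * (u ⬝ᵥ u) = 8 := by
    have h1 : P z ⬝ᵥ P z = P x ⬝ᵥ P x :=
      (hP.normSq_eq h hδ hK hyz).trans (hP.normSq_eq h hδ hK hxy)
    rw [hu] at hrad ⊢
    simp only [dotProduct_sub, sub_dotProduct] at hrad ⊢
    rw [dotProduct_comm (P z) (P x), h1]
    linarith
  have hsq : K * (((S.card : ℝ) • u) ⬝ᵥ ((S.card : ℝ) • u)) = 16 * S.card := by
    rw [hvec, smul_dotProduct, dotProduct_smul, sum_dotProduct, smul_eq_mul, smul_eq_mul]
    have h1 : ∀ y ∈ S, K * ((P y - P x) ⬝ᵥ ∑ y' ∈ S, (P y' - P x)) = 4 := by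
      intro y hy
      rw [dotProduct_sum, sum_eq_single y]
      · exact hP.norm_eq h hδ (mem_filter.1 hy).2.1
      · intro y' hy' hne
        exact hP.inner_eq_zero h (mem_filter.1 hy).2.1 (mem_filter.1 hy').2.1 hne.symm
      · exact fun hn => absurd hy hn
    have h2 : K * ∑ y ∈ S, (P y - P x) ⬝ᵥ ∑ y' ∈ S, (P y' - P x) = 4 * S.card := by
      rw [mul_sum, sum_congr rfl h1, sum_const, nsmul_eq_mul]; ring
    linarith
  rw [smul_dotProduct, dotProduct_smul, smul_eq_mul, smul_eq_mul] at hsq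
  have hcard : S.card = 2 := by
    have : (S.card : ℝ) * S.card * 8 = 16 * S.card := by
      rw [← hsq, ← hnorm]; ring
    have h3 : (S.card : ℝ) = 2 := by
      have h4 : (S.card : ℝ) * (S.card - 2) = 0 := by linarith
      linarith [(mul_eq_zero.1 h4).resolve_left hk.ne']
    exact_mod_cast h3
  obtain ⟨y', hy'⟩ : ∃ y', S.erase y = {y'} := card_eq_one.1 (by rw [card_erase_of_mem hyS, hcard])
  have hy'S : y' ∈ S := mem_of_mem_erase (hy' ▸ mem_singleton_self y')
  have hy'2 := (mem_filter.1 hy'S).2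
  refine ⟨y', hy'2.1, hy'2.2, ?_⟩
  rw [← add_sum_erase S _ hyS, hy', sum_singleton, hcard, Nat.cast_ofNat] at hvec
  exact smul_right_injective _ (two_ne_zero (α := ℝ)) hvec

/-- y and y' are not adjacent and share the neighbour x; z is the other common neighbour. -/
theorem exists_square {x y y' : V} (hy : 0 < q x y) (hy' : 0 < q x y') (hne : y ≠ y') :
    ∃ z, 0 < q y z ∧ 0 < q y' z ∧ P z = P y + P y' - P x := by
  obtain ⟨z, hz, hz', hPz⟩ := hP.exists_opposite h hδ hK hne (hP.not_adj h hδ hy hy' hne)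
    (h.pos_symm hδ hy) hy'
  refine ⟨z, hz, h.pos_symm hδ hz', ?_⟩
  have : P z = P y' - P y - (P x - P y) + P y := by rw [hPz]; abel
  rw [this]; abel

/-- Parallel transport of the d edge vectors at x₀: crossing an edge, a square carries every other
edge to a parallel one, and the crossed edge is reversed. -/
theorem exists_directions (x₀ : V) : ∃ E : Fin d → Fin d → ℝ,
    (∀ i j, K * (E i ⬝ᵥ E j) = if i = j then 4 else 0) ∧
    ∀ x i, ∃ y, 0 < q x y ∧ (P y - P x = E i ∨ P y - P x = -E i) := by
  classical
  let e := (univ.filter fun y => 0 < q x₀ y).equivFinOfCardEq (hP.card_eq h x₀)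
  have ha : ∀ i, 0 < q x₀ (e.symm i) := fun i => (mem_filter.1 (e.symm i).2).2
  refine ⟨fun i => P (e.symm i) - P x₀, fun i j => ?_, fun x => ?_⟩
  · split_ifs with hij
    · subst hij; exact hP.norm_eq h hδ (ha i)
    · rw [hP.inner_eq_zero h (ha i) (ha j) (fun hc => hij (e.symm.injective (Subtype.ext hc))),
        mul_zero]
  · induction h.reflTransGen hδ x₀ x with
    | refl => exact fun i => ⟨e.symm i, ha i, Or.inl rfl⟩
    | @tail x z _ hz ih =>
      intro i
      obtain ⟨y, hy, hPy⟩ := ih i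
      by_cases hyz : z = y
      · subst hyz
        refine ⟨x, h.pos_symm hδ hz, ?_⟩
        rcases hPy with hPy | hPy
        · right; rw [← hPy]; abel
        · left; rw [← neg_sub, hPy, neg_neg]
      · obtain ⟨u, hu, -, hPu⟩ := hP.exists_square h hδ hK hz hy hyz
        refine ⟨u, hu, ?_⟩
        have : P u - P z = P y - P x := by rw [hPu]; abel
        rwa [this]

/-- τ_i moves along the unique edge parallel to E_i; uniqueness holds because distinct edges at a
vertex are orthogonal. Uniqueness makes the τ_i involutions, squares make them commute, and the
degree bound leaves no other edges. -/
theorem exists_cube [Nonempty V] : ∃ e : V ≃ (Fin d → Bool), ∀ x y,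
    (0 < q x y ↔ (hypercubeGraph d).Adj (e x) (e y)) := by
  classical
  obtain ⟨x₀⟩ := ‹Nonempty V›
  obtain ⟨E, hE, hdir⟩ := hP.exists_directions h hδ hK x₀
  choose τ' hτ' hPτ' using hdir
  let τ : Fin d → V → V := fun i x => τ' x i
  have hτ : ∀ i x, 0 < q x (τ i x) := fun i x => hτ' x i
  have hPτ : ∀ i x, ∃ σ : ℝ, σ * σ = 1 ∧ P (τ i x) - P x = σ • E i := by
    intro i x
    rcases hPτ' x i with h1 | h1
    · exact ⟨1, by norm_num, by rw [one_smul]; exact h1⟩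
    · exact ⟨-1, by norm_num, by rw [neg_one_smul]; exact h1⟩
  have hEE : ∀ i, K * (E i ⬝ᵥ E i) = 4 := fun i => by rw [hE, if_pos rfl]
  have hEne : ∀ i j, i ≠ j → E i ⬝ᵥ E j = 0 := fun i j hij => by
    have := hE i j
    rw [if_neg hij] at this
    exact (mul_eq_zero.1 this).resolve_left hK.ne'
  have huniq : ∀ i x y (σ : ℝ), 0 < q x y → σ * σ = 1 → P y - P x = σ • E i → y = τ i x := by
    intro i x y σ hy hσ hPy
    by_contra hne
    obtain ⟨σ', hσ', h1⟩ := hPτ i x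
    have h2 := hP.inner_eq_zero h hy (hτ i x) hne
    rw [hPy, h1, smul_dotProduct, dotProduct_smul, smul_eq_mul, smul_eq_mul] at h2
    have h3 := hEE i
    have h4 : σ ≠ 0 := by rintro rfl; simp at hσ
    have h5 : σ' ≠ 0 := by rintro rfl; simp at hσ'
    have h6 : E i ⬝ᵥ E i = 0 := by simpa [h4, h5] using h2
    rw [h6] at h3
    norm_num at h3
  have hne : ∀ i j x, i ≠ j → τ i x ≠ τ j x := by
    intro i j x hij heq
    obtain ⟨σ, hσ, h1⟩ := hPτ i x
    obtain ⟨σ', hσ', h2⟩ := hPτ j x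
    have h3 := hP.norm_eq h hδ (hτ i x)
    nth_rewrite 2 [heq] at h3
    rw [h1, h2, smul_dotProduct, dotProduct_smul, hEne i j hij] at h3
    norm_num at h3
  have hinv : ∀ i x, τ i (τ i x) = x := by
    intro i x
    obtain ⟨σ, hσ, h1⟩ := hPτ i x
    refine (huniq i (τ i x) x (-σ) (h.pos_symm hδ (hτ i x)) (by linarith) ?_).symm
    rw [neg_smul, ← h1]; abel
  have hcomm : ∀ i j x, τ i (τ j x) = τ j (τ i x) := by
    intro i j x
    by_cases hij : i = j
    · subst hij; rfl
    obtain ⟨z, hz, hz', hPz⟩ := hP.exists_square h hδ hK (hτ i x) (hτ j x) (hne i j x hij)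
    obtain ⟨σ, hσ, h1⟩ := hPτ i x
    obtain ⟨σ', hσ', h2⟩ := hPτ j x
    rw [← huniq i (τ j x) z σ hz' hσ (by rw [hPz, ← h1]; abel),
      ← huniq j (τ i x) z σ' hz hσ' (by rw [hPz, ← h2]; abel)]
  have hadj : ∀ x y, 0 < q x y ↔ ∃ i, y = τ i x := by
    intro x y
    refine ⟨fun hy => ?_, by rintro ⟨i, rfl⟩; exact hτ i x⟩
    have hsub : univ.image (fun i => τ i x) ⊆ univ.filter fun y => 0 < q x y := by
      intro z hz
      obtain ⟨i, -, rfl⟩ := mem_image.1 hz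
      simp [hτ i x]
    have hcard : (univ.image (fun i => τ i x)).card = d := by
      rw [card_image_of_injective, card_univ, Fintype.card_fin]
      intro i j hij
      by_contra hcon
      exact hne i j x hcon hij
    have := eq_of_subset_of_card_le hsub (by rw [hcard]; exact h.card_pos_le x)
    have hy' : y ∈ univ.image (fun i => τ i x) := by rw [this]; simp [hy]
    obtain ⟨i, -, hi⟩ := mem_image.1 hy'
    exact ⟨i, hi.symm⟩
  have hconn : ∀ x y, Relation.ReflTransGen (fun x y => ∃ i, y = τ i x) x y := fun x y =>
    Relation.ReflTransGen.mono (fun a b hab => (hadj a b).1 hab) x y (h.reflTransGen hδ x y)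
  -- If the step from x is σE_i, the radial identity gives K⟨P x, E_i⟩ = −2σ, and K|E_i|² = 4 makes
  -- it +2σ after the step. Other signs do not change, by orthogonality.
  let b : V → Fin d → Bool := fun x i => decide (0 < P x ⬝ᵥ E i)
  have hb : ∀ i x, b (τ i x) = Function.update (b x) i (!b x i) := by
    intro i x
    obtain ⟨σ, hσ, h1⟩ := hPτ i x
    have hPe : P (τ i x) = P x + σ • E i := by rw [← h1]; abel
    funext j
    by_cases hj : j = i
    · subst hj
      have h2 := hP.radial_eq h (hτ j x)
      rw [h1, dotProduct_smul, smul_eq_mul] at h2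
      have h3 : K * (P x ⬝ᵥ E j) = -2 * σ := by
        linear_combination σ * h2 - K * (P x ⬝ᵥ E j) * hσ
      have h4 : P (τ j x) ⬝ᵥ E j = -(P x ⬝ᵥ E j) := by
        have : K * (P (τ j x) ⬝ᵥ E j) = K * -(P x ⬝ᵥ E j) := by
          rw [hPe, add_dotProduct, smul_dotProduct, smul_eq_mul]
          linear_combination 2 * h3 + σ * hEE j
        exact mul_left_cancel₀ hK.ne' this
      have h5 : P x ⬝ᵥ E j ≠ 0 := by
        intro h0
        rw [h0, mul_zero] at h3
        have : σ = 0 := by linarith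
        rw [this] at hσ; norm_num at hσ
      simp only [b, Function.update_self, h4]
      rcases lt_or_gt_of_ne h5 with h6 | h6
      · simp [h6, h6.le]
      · simp [h6, h6.le]
    · simp only [b, Function.update_of_ne hj, hPe, add_dotProduct, smul_dotProduct,
        hEne i j (Ne.symm hj), smul_zero, add_zero]
  have hbij := bijective_of_flip hinv hcomm hconn hb
  refine ⟨Equiv.ofBijective b hbij, fun x y => ?_⟩
  rw [hadj, hypercubeGraph_adj_iff]
  refine exists_congr fun i => ?_
  rw [Equiv.ofBijective_apply, Equiv.ofBijective_apply, ← hb]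
  exact hbij.1.eq_iff.symm

end Position

end GraphKernel

/-! ### Compactness: a spectral gap around the cube -/

namespace GraphKernel

open Finset

/-- The edge degrees of the hypercube with constant edge degree `K / 2`. -/
noncomputable def cubeRate (d : ℕ) (K : ℝ) (a b : Fin d → Bool) : ℝ :=
  open Classical in if (hypercubeGraph d).Adj a b then K / 2 else 0

variable {d : ℕ} {D δ K c : ℝ}

theorem Regular.exists_cube_of_frame {V : Type*} [Fintype V] [Nonempty V] {q : V → V → ℝ}
    {m : V → ℝ} {f : Fin d → V → ℝ} {μ : Fin d → ℝ} (h : Regular q m d D δ K c) (hδ : 1 ≤ δ)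
    (hc : 0 ≤ c) (hK : 0 < K) (hf : EigenFrame q m K 0 f μ) :
    ∃ e : V ≃ (Fin d → Bool), ∀ x y, q x y = cubeRate d K (e x) (e y) := by
  have hP := hf.position h hδ hc hK le_rfl zero_le_one
  rw [Real.sqrt_zero, mul_zero] at hP
  have hδ0 : 0 < δ := by linarith
  obtain ⟨e, he⟩ := hP.exists_cube h hδ0 hK
  refine ⟨e, fun x y => ?_⟩
  unfold cubeRate
  split_ifs with hxy
  · exact hP.q_eq h hδ0 hK ((he x y).2 hxy)
  · exact le_antisymm (not_lt.1 fun hq => hxy ((he x y).1 hq)) (h.nonneg x y)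

/-- Kernel, reversing measure, eigenfunctions and eigenvalues on `n` vertices. -/
abbrev FrameData (n d : ℕ) : Type :=
  (Fin n → Fin n → ℝ) × (Fin n → ℝ) × (Fin d → Fin n → ℝ) × (Fin d → ℝ)

/-- Positivity of edges and connectedness do not survive limits. Hence the degree bound is phrased
as a zero in every set of more than d vertices, and connectedness is encoded in the Poincaré
inequality with a fixed constant. -/
theorem isClosed_regular (n d : ℕ) (D δ K c : ℝ) :
    IsClosed {p : FrameData n d | Regular p.1 p.2.1 d D δ K c} := by
  have : {p : FrameData n d | Regular p.1 p.2.1 d D δ K c} =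
      {p | (∀ x y, 0 ≤ p.1 x y) ∧ (∀ x, p.1 x x = 0) ∧
        (∀ x y, p.2.1 x * p.1 x y = p.2.1 y * p.1 y x) ∧ (∀ x, δ⁻¹ ≤ p.2.1 x) ∧
        (∀ x, p.2.1 x ≤ δ) ∧ (∀ x, ∑ y, p.1 x y ≤ D) ∧
        (∀ (x : Fin n) (S : Finset (Fin n)), d < S.card → ∃ y ∈ S, p.1 x y = 0) ∧
        CD (full (Fin n)) p.1 K ∧
        ∀ (f : Fin n → ℝ) (x y : Fin n),
          (f x - f y) ^ 2 ≤ c * ∑ z, gam (full (Fin n)) p.1 f f z} := by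
    ext p
    exact ⟨fun h => ⟨h.1, h.2, h.3, h.4, h.5, h.6, h.7, h.8, h.9⟩,
      fun ⟨h1, h2, h3, h4, h5, h6, h7, h8, h9⟩ => ⟨h1, h2, h3, h4, h5, h6, h7, h8, h9⟩⟩
  rw [this]
  simp only [CD, gam2, gam, lap, Set.ofPred_and, Set.ofPred_forall]
  refine IsClosed.inter ?_ <| IsClosed.inter ?_ <| IsClosed.inter ?_ <| IsClosed.inter ?_ <|
    IsClosed.inter ?_ <| IsClosed.inter ?_ <| IsClosed.inter ?_ <| IsClosed.inter ?_ ?_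
  · exact isClosed_iInter fun x => isClosed_iInter fun y => isClosed_le (by fun_prop) (by fun_prop)
  · exact isClosed_iInter fun x => isClosed_eq (by fun_prop) (by fun_prop)
  · exact isClosed_iInter fun x => isClosed_iInter fun y => isClosed_eq (by fun_prop) (by fun_prop)
  · exact isClosed_iInter fun x => isClosed_le (by fun_prop) (by fun_prop)
  · exact isClosed_iInter fun x => isClosed_le (by fun_prop) (by fun_prop)
  · exact isClosed_iInter fun x => isClosed_le (by fun_prop) (by fun_prop)
  · refine isClosed_iInter fun x => isClosed_iInter fun S => isClosed_iInter fun _ => ?_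
    have : {p : FrameData n d | ∃ y ∈ S, p.1 x y = 0} = ⋃ y ∈ S, {p | p.1 x y = 0} := by
      ext p; simp
    rw [this]
    exact isClosed_biUnion_finset fun y _ => isClosed_eq (by fun_prop) (by fun_prop)
  · exact isClosed_iInter fun x => isClosed_iInter fun y => isClosed_le (by fun_prop) (by fun_prop)
  · exact isClosed_iInter fun f => isClosed_iInter fun x => isClosed_iInter fun y =>
      isClosed_le (by fun_prop) (by fun_prop)

theorem isClosed_eigenFrame (n d : ℕ) (K ε : ℝ) :
    IsClosed {p : FrameData n d | EigenFrame p.1 p.2.1 K ε p.2.2.1 p.2.2.2} := by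
  have : {p : FrameData n d | EigenFrame p.1 p.2.1 K ε p.2.2.1 p.2.2.2} =
      {p | (∀ i j, ∑ x, p.2.1 x * (p.2.2.1 i x * p.2.2.1 j x) = if i = j then 1 else 0) ∧
        (∀ i x, lap (full (Fin n)) p.1 (p.2.2.1 i) x = -(p.2.2.2 i * p.2.2.1 i x)) ∧
        (∀ i, K ≤ p.2.2.2 i) ∧ ∀ i, p.2.2.2 i ≤ K + ε} := by
    ext p
    exact ⟨fun h => ⟨h.1, h.2, h.3, h.4⟩, fun ⟨h1, h2, h3, h4⟩ => ⟨h1, h2, h3, h4⟩⟩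
  rw [this]
  simp only [lap, Set.ofPred_and, Set.ofPred_forall]
  refine IsClosed.inter ?_ <| IsClosed.inter ?_ <| IsClosed.inter ?_ ?_
  · exact isClosed_iInter fun x => isClosed_iInter fun y => isClosed_eq (by fun_prop) (by fun_prop)
  · exact isClosed_iInter fun x => isClosed_iInter fun y => isClosed_eq (by fun_prop) (by fun_prop)
  · exact isClosed_iInter fun x => isClosed_le (by fun_prop) (by fun_prop)
  · exact isClosed_iInter fun x => isClosed_le (by fun_prop) (by fun_prop)

/-- The data with ε = 1 that stay η-far from every cube labelling form a compact set. There Σ(μ_i −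
K) is positive by rigidity, so it has a positive lower bound t. -/
theorem exists_gap (n : ℕ) (hn : 0 < n) (hδ : 1 ≤ δ) (hc : 0 ≤ c) (hK : 0 < K) {η : ℝ}
    (hη : 0 < η) : ∃ ε₀ : ℝ, 0 < ε₀ ∧ ∀ ε ≤ ε₀, ∀ (q : Fin n → Fin n → ℝ) (m : Fin n → ℝ)
      (f : Fin d → Fin n → ℝ) (μ : Fin d → ℝ), Regular q m d D δ K c →
      EigenFrame q m K ε f μ →
      ∃ e : Fin n ≃ (Fin d → Bool), ∀ x y, |q x y - cubeRate d K (e x) (e y)| < η := by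
  have : Nonempty (Fin n) := ⟨⟨0, hn⟩⟩
  set S : Set (FrameData n d) := ({p | Regular p.1 p.2.1 d D δ K c} ∩
    {p | EigenFrame p.1 p.2.1 K 1 p.2.2.1 p.2.2.2}) ∩
    {p | ∀ e : Fin n ≃ (Fin d → Bool), ∃ x y, η ≤ |p.1 x y - cubeRate d K (e x) (e y)|} with hS
  have hcompact : IsCompact S := by
    refine IsCompact.of_isClosed_subset (isCompact_Icc (a := ((fun _ _ => 0, fun _ => δ⁻¹,
      fun _ _ => -δ, fun _ => K) : FrameData n d)) (b := (fun _ _ => D, fun _ => δ,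
      fun _ _ => δ, fun _ => K + 1))) ?_ ?_
    · refine ((isClosed_regular n d D δ K c).inter (isClosed_eigenFrame n d K 1)).inter ?_
      simp only [Set.ofPred_forall, Set.ofPred_exists]
      refine isClosed_iInter fun e => isClosed_iUnion_of_finite fun x =>
        isClosed_iUnion_of_finite fun y => isClosed_le (by fun_prop) (by fun_prop)
    · rintro p ⟨⟨h, hf⟩, -⟩
      exact ⟨⟨fun x y => h.nonneg x y, fun x => h.le_m x,
          fun i x => (abs_le.1 (hf.abs_le h hδ i x)).1, fun i => hf.le_mu i⟩,
        ⟨fun x y => h.q_le x y, fun x => h.m_le x,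
          fun i x => (abs_le.1 (hf.abs_le h hδ i x)).2, fun i => hf.mu_le i⟩⟩
  have hpos : ∀ p ∈ S, 0 < ∑ i, (p.2.2.2 i - K) := by
    rintro p ⟨⟨h, hf⟩, hfar⟩
    refine (sum_nonneg fun i _ => by linarith [hf.le_mu i]).lt_of_ne' fun h0 => ?_
    have h1 := (sum_eq_zero_iff_of_nonneg fun i _ => by linarith [hf.le_mu i]).1 h0
    have hf0 : EigenFrame p.1 p.2.1 K 0 p.2.2.1 p.2.2.2 :=
      ⟨hf.orth, hf.eig, hf.le_mu, fun i => by linarith [h1 i (mem_univ i)]⟩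
    obtain ⟨e, he⟩ := h.exists_cube_of_frame hδ hc hK hf0
    obtain ⟨x, y, hxy⟩ := hfar e
    rw [he, sub_self, abs_zero] at hxy
    linarith
  obtain ⟨t, ht, hSt⟩ : ∃ t : ℝ, 0 < t ∧ ∀ p ∈ S, t ≤ ∑ i, (p.2.2.2 i - K) := by
    rcases S.eq_empty_or_nonempty with hempty | hne
    · exact ⟨1, one_pos, by simp [hempty]⟩
    · obtain ⟨p, hp, hmin⟩ := hcompact.exists_isMinOn hne
        (f := fun p : FrameData n d => ∑ i, (p.2.2.2 i - K)) (by fun_prop)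
      exact ⟨_, hpos p hp, fun p' hp' => hmin hp'⟩
  have hd1 : (0 : ℝ) < d + 1 := by positivity
  -- d deviations of size at most t/(d + 1) add up to less than t, also for d = 0.
  refine ⟨min 1 (t / (d + 1)), lt_min one_pos (by positivity), fun ε hε q m f μ h hf => ?_⟩
  by_contra! hcon
  have hmem : ((q, m, f, μ) : FrameData n d) ∈ S :=
    ⟨⟨h, hf.orth, hf.eig, hf.le_mu, fun i => (hf.mu_le i).trans
      (by linarith [hε.trans (min_le_left _ _)])⟩, hcon⟩
  have h1 := hSt _ hmem
  have h2 : ∑ i, (μ i - K) ≤ ∑ _i : Fin d, t / (d + 1) :=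
    sum_le_sum fun i _ => by linarith [hf.mu_le i, hε.trans (min_le_right _ _)]
  rw [sum_const, card_univ, Fintype.card_fin, nsmul_eq_mul] at h2
  have h3 : (d : ℝ) * (t / (d + 1)) < t := by
    rw [mul_div_assoc', div_lt_iff₀ hd1]; linarith
  simp only at h1
  linarith

end GraphKernel

/-! ### Diameter bound and finiteness -/

namespace GraphKernel

open Finset

section Reach

variable {V : Type*} [DecidableEq V]

/-- The vertices that can be reached from `x` in at most `k` steps along `N`. -/
def reach (N : V → Finset V) : ℕ → V → Finset V
  | 0, x => {x}
  | k + 1, x => insert x ((N x).biUnion (reach N k))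

theorem self_mem_reach (N : V → Finset V) (k : ℕ) (x : V) : x ∈ reach N k x := by
  cases k <;> simp [reach]

theorem card_reach_le {N : V → Finset V} {d : ℕ} (hN : ∀ x, (N x).card ≤ d) (k : ℕ) (x : V) :
    (reach N k x).card ≤ (1 + d) ^ k := by
  induction k generalizing x with
  | zero => simp [reach]
  | succ k ih =>
    have h1 : ((N x).biUnion (reach N k)).card ≤ (N x).card * (1 + d) ^ k :=
      card_biUnion_le_card_mul _ _ _ fun z _ => ih z
    have h2 := Nat.mul_le_mul_right ((1 + d) ^ k) (hN x)
    have h3 : 1 ≤ (1 + d) ^ k := Nat.one_le_pow _ _ (by omega)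
    calc (reach N (k + 1) x).card ≤ ((N x).biUnion (reach N k)).card + 1 := card_insert_le _ _
      _ ≤ d * (1 + d) ^ k + (1 + d) ^ k := by omega
      _ = (1 + d) ^ (k + 1) := by ring

theorem mem_reach_of_walk {G : SimpleGraph V} {N : V → Finset V}
    (hN : ∀ x y, G.Adj x y → y ∈ N x) {x y : V} (p : G.Walk x y) {k : ℕ} (hk : p.length ≤ k) :
    y ∈ reach N k x := by
  induction p generalizing k with
  | nil => exact self_mem_reach _ _ _
  | @cons u v w huv p ih =>
    cases k with
    | zero => simp at hk
    | succ k =>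
      rw [SimpleGraph.Walk.length_cons] at hk
      exact mem_insert_of_mem (mem_biUnion.2 ⟨v, hN _ _ huv, ih (by omega)⟩)

end Reach

end GraphKernel

namespace WeightedGraph

open GraphKernel Finset

variable {V : Type*} {G : WeightedGraph V} {N : V → Finset V}

theorem laplacian_eq_lap (hN : ∀ x y, G.w x y ≠ 0 → y ∈ N x) (f : V → ℝ) :
    G.laplacian f = lap N G.q f := by
  funext x
  rw [laplacian, lap, finsum_eq_sum_of_support_subset (s := N x), sum_div]
  · exact sum_congr rfl fun y _ => by rw [q]; ring
  · intro y hy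
    exact hN x y (left_ne_zero_of_mul hy)

theorem wdeg_eq_sum (hN : ∀ x y, G.w x y ≠ 0 → y ∈ N x) (x : V) :
    G.wdeg x = ∑ y ∈ N x, G.q x y := by
  rw [wdeg, finsum_eq_sum_of_support_subset (s := N x), sum_div]
  · rfl
  · exact fun y hy => hN x y hy

theorem gam_eq_gam (hN : ∀ x y, G.w x y ≠ 0 → y ∈ N x) (f g : V → ℝ) :
    G.gam f g = GraphKernel.gam N G.q f g := by
  funext x
  simp only [WeightedGraph.gam, laplacian_eq_lap hN, Pi.smul_apply, Pi.sub_apply, Pi.mul_apply,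
    smul_eq_mul, GraphKernel.gam, lap, mul_sum]
  rw [← sum_sub_distrib, ← sum_sub_distrib, mul_sum]
  exact sum_congr rfl fun y _ => by ring

theorem gam2_eq_gam2 (hN : ∀ x y, G.w x y ≠ 0 → y ∈ N x) (f g : V → ℝ) :
    G.gam2 f g = GraphKernel.gam2 N G.q f g := by
  funext x
  simp only [WeightedGraph.gam2, laplacian_eq_lap hN, gam_eq_gam hN, Pi.smul_apply, Pi.sub_apply,
    smul_eq_mul, GraphKernel.gam2]

theorem CDInfty.cd {K : ℝ} (h : G.CDInfty K) (hN : ∀ x y, G.w x y ≠ 0 → y ∈ N x) :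
    CD N G.q K := fun f x => by
  rw [← gam_eq_gam hN, ← gam2_eq_gam2 hN]; exact h f x

theorem q_nonneg (G : WeightedGraph V) (x y : V) : 0 ≤ G.q x y :=
  div_nonneg (G.w_nonneg x y) (G.m_pos x).le

theorem q_pos_iff {x y : V} : 0 < G.q x y ↔ G.toSimpleGraph.Adj x y :=
  div_pos_iff_of_pos_right (G.m_pos x)

theorem m_mul_q (G : WeightedGraph V) (x y : V) : G.m x * G.q x y = G.w x y :=
  mul_div_cancel₀ _ (G.m_pos x).ne'

theorem reflTransGen_of_connected (h : G.toSimpleGraph.Connected) (x y : V) :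
    Relation.ReflTransGen (fun x y => 0 < G.q x y) x y :=
  Relation.ReflTransGen.mono (fun _ _ hab => q_pos_iff.2 hab) x y
    ((SimpleGraph.reachable_iff_reflTransGen x y).1 (h.preconnected x y))

namespace MemClass

variable {D δ K : ℝ} {d : ℕ} (h : G.MemClass D d δ)
include h

theorem deg_le (x : V) : G.deg x ≤ d := h.degMax_eq ▸ le_iSup G.deg x

theorem finite_neighborSet (x : V) : (G.toSimpleGraph.neighborSet x).Finite :=
  Set.encard_lt_top_iff.1 ((h.deg_le x).trans_lt (ENat.natCast_lt_top d))

/-- A finite supremum of natural numbers is attained; d > 0 excludes truncation in d − 1. -/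
theorem exists_deg_eq (hd : 0 < d) : ∃ x, G.deg x = d := by
  by_contra! hcon
  have h1 : G.degMax ≤ ((d - 1 : ℕ) : ℕ∞) := iSup_le fun x => by
    have h2 := lt_of_le_of_ne (h.deg_le x) (hcon x)
    obtain ⟨n, hn⟩ := ENat.ne_top_iff_exists.1 (h2.trans (ENat.natCast_lt_top d)).ne
    rw [← hn] at h2 ⊢
    have : n < d := by exact_mod_cast h2
    exact_mod_cast (by omega : n ≤ d - 1)
  rw [h.degMax_eq] at h1
  have : d ≤ d - 1 := by exact_mod_cast h1
  omega

/-- The finite set of neighbours of a vertex. -/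
noncomputable def nbr (x : V) : Finset V := (h.finite_neighborSet x).toFinset

theorem mem_nbr {x y : V} : y ∈ h.nbr x ↔ 0 < G.w x y := by
  simp [nbr, toSimpleGraph]

theorem mem_nbr_of_ne (x y : V) (hw : G.w x y ≠ 0) : y ∈ h.nbr x :=
  h.mem_nbr.2 ((G.w_nonneg x y).lt_of_ne' hw)

theorem card_nbr_le (x : V) : (h.nbr x).card ≤ d := by
  have := h.deg_le x
  rw [deg, ← (h.finite_neighborSet x).coe_toFinset, Set.encard_coe_eq_coe_finsetCard] at this
  exact_mod_cast this

theorem lt_card [Fintype V] (hd : 0 < d) : d < Fintype.card V := by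
  classical
  obtain ⟨x, hx⟩ := h.exists_deg_eq hd
  have h1 : (h.nbr x).card = d := by
    rw [deg, ← (h.finite_neighborSet x).coe_toFinset, Set.encard_coe_eq_coe_finsetCard] at hx
    exact_mod_cast hx
  have h2 : x ∉ h.nbr x := by rw [h.mem_nbr, G.w_self]; exact lt_irrefl 0
  rw [← h1]
  exact card_lt_univ_of_notMem h2

/-- Bonnet–Myers: the distance to x is 1-Lipschitz, so its Γ is at most D/2. -/
theorem dist_sq_le (hK : 0 < K) (hCD : G.CDInfty K) (x y : V) :
    (G.toSimpleGraph.dist x y : ℝ) ^ 2 ≤ oscConst D K * (D / 2) := by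
  have hsum : ∀ x, ∑ y ∈ h.nbr x, G.q x y ≤ D := fun x => by
    rw [← wdeg_eq_sum h.mem_nbr_of_ne]; exact h.wdeg_le x
  have hconn : ∀ x y, Relation.ReflTransGen (fun x y => y ∈ h.nbr x ∧ 0 < G.q x y) x y :=
    fun x y => Relation.ReflTransGen.mono (fun a b hab =>
      ⟨h.mem_nbr.2 (q_pos_iff.1 hab), hab⟩) x y (reflTransGen_of_connected h.connected x y)
  have key := sq_sub_le_of_gam_le (N := h.nbr) G.q_nonneg hsum hK (hCD.cd h.mem_nbr_of_ne) hconn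
    (f := fun z => (G.toSimpleGraph.dist x z : ℝ)) (B := D / 2) ?_ y x
  · simpa using key
  · intro z
    rw [GraphKernel.gam]
    have : ∑ u ∈ h.nbr z, G.q z u * (((G.toSimpleGraph.dist x u : ℝ) - G.toSimpleGraph.dist x z) *
        ((G.toSimpleGraph.dist x u : ℝ) - G.toSimpleGraph.dist x z)) ≤ ∑ u ∈ h.nbr z, G.q z u := by
      refine sum_le_sum fun u hu => mul_le_of_le_one_right (G.q_nonneg z u) ?_
      have hadj : G.toSimpleGraph.Adj z u := h.mem_nbr.1 hu
      have h1 := h.connected.dist_triangle (u := x) (v := z) (w := u)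
      have h2 := h.connected.dist_triangle (u := x) (v := u) (w := z)
      rw [SimpleGraph.dist_eq_one_iff_adj.2 hadj] at h1
      rw [SimpleGraph.dist_eq_one_iff_adj.2 hadj.symm] at h2
      have h3 : (G.toSimpleGraph.dist x u : ℝ) ≤ G.toSimpleGraph.dist x z + 1 := by exact_mod_cast h1
      have h4 : (G.toSimpleGraph.dist x z : ℝ) ≤ G.toSimpleGraph.dist x u + 1 := by exact_mod_cast h2
      rw [← sq, sq_le_one_iff_abs_le_one, abs_le]
      constructor <;> linarith
    linarith [hsum z]

/-- An upper bound for the number of vertices. -/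
noncomputable def _root_.WeightedGraph.cardBound (D : ℝ) (d : ℕ) (K : ℝ) : ℕ :=
  (1 + d) ^ ⌈Real.sqrt (oscConst D K * (D / 2))⌉₊

theorem exists_covering (hK : 0 < K) (hCD : G.CDInfty K) :
    ∃ S : Finset V, (∀ y, y ∈ S) ∧ S.card ≤ cardBound D d K := by
  classical
  obtain ⟨x⟩ := h.connected.nonempty
  refine ⟨reach h.nbr ⌈Real.sqrt (oscConst D K * (D / 2))⌉₊ x, fun y => ?_,
    card_reach_le h.card_nbr_le _ x⟩
  obtain ⟨p, hp⟩ := (h.connected.preconnected x y).exists_walk_length_eq_dist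
  refine mem_reach_of_walk (fun x y hxy => h.mem_nbr.2 hxy) p ?_
  rw [hp]
  have h1 := Real.le_sqrt_of_sq_le (h.dist_sq_le hK hCD x y)
  exact_mod_cast h1.trans (Nat.le_ceil _)

theorem finite (hK : 0 < K) (hCD : G.CDInfty K) : Finite V := by
  obtain ⟨S, hS, -⟩ := h.exists_covering hK hCD
  exact Set.finite_univ_iff.1 (S.finite_toSet.subset fun y _ => hS y)

theorem card_le [Fintype V] (hK : 0 < K) (hCD : G.CDInfty K) :
    Fintype.card V ≤ cardBound D d K := by
  obtain ⟨S, hS, hcard⟩ := h.exists_covering hK hCD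
  exact (card_le_card fun y _ => hS y).trans hcard

end MemClass

end WeightedGraph

/-! ### Graphs as regular kernels; Lichnerowicz and the eigenframe -/

namespace GraphKernel

open Finset

theorem Regular.of_connected {V : Type*} [Fintype V] {q : V → V → ℝ} {m : V → ℝ} {d : ℕ}
    {D δ K : ℝ} (hK : 0 < K) (hq : ∀ x y, 0 ≤ q x y) (hdiag : ∀ x, q x x = 0)
    (hrev : ∀ x y, m x * q x y = m y * q y x) (hm : ∀ x, δ⁻¹ ≤ m x) (hm' : ∀ x, m x ≤ δ)
    (hD : ∀ x, ∑ y, q x y ≤ D)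
    (hcard : ∀ (x : V) (S : Finset V), d < S.card → ∃ y ∈ S, q x y = 0)
    (hcd : CD (full V) q K) (hconn : ∀ x y, Relation.ReflTransGen (fun x y => 0 < q x y) x y) :
    Regular q m d D δ K (oscConst D K) where
  nonneg := hq
  diag := hdiag
  rev := hrev
  le_m := hm
  m_le := hm'
  sum_le := hD
  card_le := hcard
  cd := hcd
  osc f x y := sq_sub_le_of_gam_le hq hD hK hcd (fun x y => by simpa using hconn x y)
    (fun z => single_le_sum (f := fun z => gam (full V) q f f z)
      (fun z _ => gam_self_nonneg hq f z) (mem_univ z)) x y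

end GraphKernel

namespace WeightedGraph

open GraphKernel Finset

theorem MemClass.regular {V : Type*} [Fintype V] {G : WeightedGraph V} {D δ K : ℝ} {d : ℕ}
    (h : G.MemClass D d δ) (hK : 0 < K) (hCD : G.CDInfty K) :
    Regular G.q G.m d D δ K (oscConst D K) := by
  refine Regular.of_connected hK G.q_nonneg (fun x => by rw [q, G.w_self, zero_div])
    (fun x y => by rw [m_mul_q, m_mul_q, G.w_symm]) h.le_m h.m_le (fun x => ?_) (fun x S hS => ?_)
    (hCD.cd fun _ y _ => mem_univ y) (reflTransGen_of_connected h.connected)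
  · rw [← wdeg_eq_sum (N := full V) fun _ y _ => mem_univ y]; exact h.wdeg_le x
  · by_contra! hcon
    have : S ⊆ h.nbr x := fun y hy =>
      h.mem_nbr.2 (q_pos_iff.1 ((G.q_nonneg x y).lt_of_ne' (hcon y hy)))
    exact absurd ((Finset.card_le_card this).trans (h.card_nbr_le x)) (not_le.2 hS)

end WeightedGraph

namespace GraphKernel

open Finset

variable {V : Type*} [Fintype V] {q : V → V → ℝ} {m : V → ℝ} {d : ℕ} {D δ K c : ℝ}

namespace Regular

variable (h : Regular q m d D δ K c) (hδ : 0 < δ)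
include h

theorem sum_gam_eq {f : V → ℝ} {ν : ℝ} (hf : ∀ x, lap (full V) q f x = -(ν * f x)) :
    ∑ x, m x * gam (full V) q f f x = ν * ∑ x, m x * (f x * f x) := by
  have := sum_mul_lap h.rev f f
  rw [eq_neg_iff_add_eq_zero, add_comm, ← eq_neg_iff_add_eq_zero] at this
  rw [this, mul_sum, ← sum_neg_distrib]
  exact sum_congr rfl fun z _ => by rw [hf]; ring

include hδ

/-- Lichnerowicz: integrate CD against m. The term ΔΓ(f) has mean zero, and ∫Γ(f) = ν, leaving Kν ≤
ν². -/
theorem le_eigenvalue {f : V → ℝ} {ν : ℝ} (hf : ∀ x, lap (full V) q f x = -(ν * f x))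
    (hnorm : ∑ x, m x * (f x * f x) = 1) (hν : ν ≠ 0) : K ≤ ν := by
  have h1 := h.sum_gam_eq hf
  rw [hnorm, mul_one] at h1
  have h2 : 0 ≤ ν := by
    rw [← h1]
    exact sum_nonneg fun x _ => mul_nonneg (h.m_pos hδ x).le (gam_self_nonneg h.nonneg f x)
  have h3 : 0 < ν := h2.lt_of_ne' hν
  have hlap : lap (full V) q f = (-ν) • f := by funext x; rw [hf]; simp
  have h4 : ∑ x, m x * (K * gam (full V) q f f x) ≤
      ∑ x, m x * (1 / 2 * lap (full V) q (gam (full V) q f f) x + ν * gam (full V) q f f x) := by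
    refine sum_le_sum fun x _ => mul_le_mul_of_nonneg_left ?_ (h.m_pos hδ x).le
    have := h.cd f x
    rw [gam2, hlap, gam_smul_right, Pi.smul_apply, smul_eq_mul] at this
    linarith
  have h5 : ∑ x, m x * lap (full V) q (gam (full V) q f f) x = 0 := by
    have := sum_mul_lap h.rev (gam (full V) q f f) (fun _ => 1)
    simp only [one_mul] at this
    rw [this, neg_eq_zero]
    exact sum_eq_zero fun x _ => by simp [gam]
  have e1 : ∑ x, m x * (K * gam (full V) q f f x) = K * ν := by
    rw [← h1, mul_sum]; exact sum_congr rfl fun x _ => by ring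
  have e2 : ∑ x, m x * (1 / 2 * lap (full V) q (gam (full V) q f f) x +
      ν * gam (full V) q f f x) = ν * ν := by
    have : ∀ x, m x * (1 / 2 * lap (full V) q (gam (full V) q f f) x +
      ν * gam (full V) q f f x) = 1 / 2 * (m x * lap (full V) q (gam (full V) q f f) x) +
        ν * (m x * gam (full V) q f f x) := fun x => by ring
    simp only [this, sum_add_distrib, ← mul_sum, h5, h1]
    ring
  rw [e1, e2] at h4
  exact le_of_mul_le_mul_right h4 h3

theorem eq_of_harmonic {f : V → ℝ} (hf : ∀ x, lap (full V) q f x = 0) (x y : V) : f x = f y := by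
  have h1 := h.sum_gam_eq (ν := 0) (f := f) (by simpa using hf)
  rw [zero_mul] at h1
  have h2 := (sum_eq_zero_iff_of_nonneg fun x _ =>
    mul_nonneg (h.m_pos hδ x).le (gam_self_nonneg (N := full V) h.nonneg f x)).1 h1
  have h3 : ∑ z, gam (full V) q f f z = 0 := sum_eq_zero fun z _ =>
    (mul_eq_zero.1 (h2 z (mem_univ z))).resolve_left (h.m_pos hδ z).ne'
  have h4 := h.osc f x y
  rw [h3, mul_zero] at h4
  have := pow_eq_zero_iff two_ne_zero |>.1 (le_antisymm h4 (sq_nonneg _))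
  linarith

/-- Harmonic functions are constant, so at most one of the more than d eigenfunctions has eigenvalue
0. At least d remain, with eigenvalues ≥ K by Lichnerowicz. -/
theorem exists_eigenFrame [DecidableEq V] {φ : V → V → ℝ} {ν : V → ℝ} {t : ℝ}
    (horth : ∀ i j, ∑ x, m x * (φ i x * φ j x) = if i = j then 1 else 0)
    (heig : ∀ i x, lap (full V) q (φ i) x = -(ν i * φ i x))
    (hcard : d < (univ.filter fun i => ν i ≤ t).card) :
    ∃ (f : Fin d → V → ℝ) (μ : Fin d → ℝ), EigenFrame q m K (t - K) f μ := by
  have hone : ((univ.filter fun i => ν i ≤ t).filter fun i => ν i = 0).card ≤ 1 := by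
    refine card_le_one.2 fun i hi j hj => ?_
    by_contra hij
    have hi0 := (mem_filter.1 hi).2
    have hj0 := (mem_filter.1 hj).2
    have ci := h.eq_of_harmonic hδ (f := φ i) fun x => by rw [heig, hi0]; ring
    have cj := h.eq_of_harmonic hδ (f := φ j) fun x => by rw [heig, hj0]; ring
    have oij := horth i j
    rw [if_neg hij] at oij
    have oii := horth i i
    have ojj := horth j j
    rw [if_pos rfl] at oii ojj
    have e : ∀ u v : V → ℝ, (∀ x y, u x = u y) → (∀ x y, v x = v y) →
        ∑ x, m x * (u x * v x) = (∑ x, m x) * (u i * v i) := by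
      intro u v hu hv
      rw [sum_mul]
      exact sum_congr rfl fun x _ => by rw [hu x i, hv x i]
    rw [e _ _ ci cj] at oij
    rw [e _ _ ci ci] at oii
    rw [e _ _ cj cj] at ojj
    have : (1 : ℝ) = 0 := by
      calc (1 : ℝ) = (∑ x, m x) * (φ i i * φ i i) * ((∑ x, m x) * (φ j i * φ j i)) := by
            rw [oii, ojj, one_mul]
        _ = ((∑ x, m x) * (φ i i * φ j i)) * ((∑ x, m x) * (φ i i * φ j i)) := by ring
        _ = 0 := by rw [oij, zero_mul]
    exact one_ne_zero this
  have hsplit := card_filter_add_card_filter_not (s := univ.filter fun i => ν i ≤ t)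
    (fun i => ν i = 0)
  obtain ⟨T, hT, hTcard⟩ := exists_subset_card_eq
    (s := (univ.filter fun i => ν i ≤ t).filter fun i => ¬ν i = 0) (n := d) (by omega)
  let e := T.equivFinOfCardEq hTcard
  have hmem : ∀ k, ν (e.symm k) ≤ t ∧ ν (e.symm k) ≠ 0 := fun k => by
    have := hT (e.symm k).2
    simp only [mem_filter, mem_univ, true_and] at this
    exact this
  refine ⟨fun k => φ (e.symm k), fun k => ν (e.symm k), fun i j => ?_, fun k x => heig _ x,
    fun k => ?_, fun k => ?_⟩
  · rw [horth]
    simp only [Subtype.coe_inj, e.symm.injective.eq_iff]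
  · refine h.le_eigenvalue hδ (heig (e.symm k)) ?_ (hmem k).2
    rw [horth, if_pos rfl]
  · linarith [(hmem k).1]

end Regular

end GraphKernel

/-! ### The spectral theorem for −Δ and the ordered eigenvalues -/

namespace WeightedGraph

open Finset

variable {V : Type*} [Fintype V] (G : WeightedGraph V)

/-- The Laplacian in the basis `δ_x / √(m x)`. -/
noncomputable def symmMatrix [DecidableEq V] : Matrix V V ℝ :=
  Matrix.diagonal (fun x => Real.sqrt (G.m x)) * LinearMap.toMatrix' (-G.laplacianLin) *
    Matrix.diagonal (fun x => (Real.sqrt (G.m x))⁻¹)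

omit [Fintype V] in
theorem sqrt_m_pos (x : V) : 0 < Real.sqrt (G.m x) := Real.sqrt_pos.2 (G.m_pos x)

theorem charpoly_symmMatrix [DecidableEq V] :
    G.symmMatrix.charpoly = (-G.laplacianLin).charpoly := by
  let u : (Matrix V V ℝ)ˣ :=
    ⟨Matrix.diagonal (fun x => Real.sqrt (G.m x)), Matrix.diagonal (fun x => (Real.sqrt (G.m x))⁻¹),
      by
        rw [Matrix.diagonal_mul_diagonal, ← Matrix.diagonal_one]
        congr 1; funext x; exact mul_inv_cancel₀ (G.sqrt_m_pos x).ne',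
      by
        rw [Matrix.diagonal_mul_diagonal, ← Matrix.diagonal_one]
        congr 1; funext x; exact inv_mul_cancel₀ (G.sqrt_m_pos x).ne'⟩
  have h1 := Matrix.charpoly_units_conj u (LinearMap.toMatrix' (-G.laplacianLin))
  have h2 := Matrix.charpoly_toLin' (LinearMap.toMatrix' (-G.laplacianLin))
  rw [Matrix.toLin'_toMatrix'] at h2
  rw [h2, ← h1, ← Matrix.coe_units_inv]
  rfl

/-- Off-diagonal entries are −w(x,y)/√(m x · m y), symmetric because w is. -/
theorem isHermitian_symmMatrix [DecidableEq V] : G.symmMatrix.IsHermitian := by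
  refine Matrix.IsHermitian.ext fun x y => ?_
  have hentry : ∀ x y, x ≠ y → G.symmMatrix x y =
      -(G.w x y / (Real.sqrt (G.m x) * Real.sqrt (G.m y))) := by
    intro x y hxy
    rw [symmMatrix, Matrix.mul_diagonal, Matrix.diagonal_mul, LinearMap.toMatrix'_apply]
    have : (-G.laplacianLin) (Pi.single y 1) x = -(G.w x y / G.m x) := by
      change -(G.laplacian _ x) = _
      rw [laplacian, finsum_eq_single _ y]
      · simp [hxy]
      · intro z hz; simp [hz, hxy]
    rw [this]
    have h1 := Real.mul_self_sqrt (G.m_pos x).le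
    have h2 := G.sqrt_m_pos x
    have h3 := G.sqrt_m_pos y
    nth_rewrite 2 [← h1]
    field_simp
  by_cases hxy : x = y
  · subst hxy; simp
  · rw [hentry x y hxy, hentry y x (Ne.symm hxy), G.w_symm y x, mul_comm (Real.sqrt (G.m y))]
    simp

theorem exists_eigenbasis : ∃ (φ : V → V → ℝ) (ν : V → ℝ),
    (∀ i j, ∑ x, G.m x * (φ i x * φ j x) = open Classical in if i = j then 1 else 0) ∧
    (∀ i x, G.laplacian (φ i) x = -(ν i * φ i x)) ∧
    (-G.laplacianLin).charpoly.roots = univ.val.map ν := by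
  classical
  have hA := G.isHermitian_symmMatrix
  refine ⟨fun i x => hA.eigenvectorBasis i x / Real.sqrt (G.m x), hA.eigenvalues, fun i j => ?_,
    fun i x => ?_, ?_⟩
  · have h1 := orthonormal_iff_ite.1 hA.eigenvectorBasis.orthonormal i j
    rw [PiLp.inner_apply] at h1
    rw [← h1]
    refine sum_congr rfl fun x _ => ?_
    have h2 := Real.mul_self_sqrt (G.m_pos x).le
    have h3 := (G.sqrt_m_pos x).ne'
    simp only [RCLike.inner_apply, conj_trivial]
    nth_rewrite 1 [← h2]
    field_simp
  · have h1 := congrFun (hA.mulVec_eigenvectorBasis i) x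
    have h2 : ∀ v : V → ℝ, G.symmMatrix.mulVec v x =
        Real.sqrt (G.m x) * -G.laplacian (fun y => v y / Real.sqrt (G.m y)) x := by
      intro v
      rw [symmMatrix, mul_assoc, ← Matrix.mulVec_mulVec, Matrix.mulVec_diagonal,
        ← Matrix.mulVec_mulVec, LinearMap.toMatrix'_mulVec]
      have : (Matrix.diagonal fun x => (Real.sqrt (G.m x))⁻¹).mulVec v =
          fun y => v y / Real.sqrt (G.m y) := by
        funext y
        rw [Matrix.mulVec_diagonal]; ring
      rw [this]
      rfl
    rw [h2] at h1
    have h4 := (G.sqrt_m_pos x).ne'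
    rw [Pi.smul_apply, smul_eq_mul] at h1
    field_simp
    linarith
  · rw [← G.charpoly_symmMatrix, hA.roots_charpoly_eq_eigenvalues]
    rfl

/-- The entries with index 0, …, k of the sorted list are all at most the k-th. -/
theorem lt_card_eigenvalue_le {ν : V → ℝ}
    (hν : (-G.laplacianLin).charpoly.roots = univ.val.map ν) {k : ℕ} (hk : k < Fintype.card V) :
    k < (univ.filter fun i => ν i ≤ G.eigenvalue k).card := by
  classical
  have hl : ((G.spectrumList : List ℝ) : Multiset ℝ) = univ.val.map ν := by
    rw [← hν]; exact Multiset.sort_eq _ _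
  have hlen : G.spectrumList.length = Fintype.card V := by
    have := congrArg Multiset.card hl
    simpa using this
  have hpw : G.spectrumList.Pairwise (· ≤ ·) := Multiset.pairwise_sort _ _
  have hk' : k < G.spectrumList.length := by omega
  have heig : G.eigenvalue k = G.spectrumList[k] := by
    rw [eigenvalue, List.getD_eq_getElem _ _ hk']
  have h1 : (univ.filter fun i => ν i ≤ G.eigenvalue k).card =
      G.spectrumList.countP fun r => decide (r ≤ G.eigenvalue k) := by
    rw [← Multiset.coe_countP, hl, Multiset.countP_map]
    rfl
  have h2 : (G.spectrumList.take (k + 1)).countP (fun r => decide (r ≤ G.eigenvalue k)) =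
      (G.spectrumList.take (k + 1)).length := by
    rw [List.countP_eq_length]
    intro a ha
    obtain ⟨i, hi, rfl⟩ := List.mem_take_iff_getElem.1 ha
    rw [decide_eq_true_eq, heig]
    rcases Nat.lt_or_ge i k with hik | hik
    · exact List.pairwise_iff_getElem.1 hpw i k _ _ hik
    · have : i = k := by omega
      subst this; exact le_rfl
  have h3 := (List.take_sublist (k + 1) G.spectrumList).countP_le
    (p := fun r => decide (r ≤ G.eigenvalue k))
  rw [h2, List.length_take] at h3
  rw [h1]
  omega

end WeightedGraph

/-! ### Relabelling vertices; a gap uniform in their number -/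

namespace GraphKernel

open Finset

section Transport

variable {V W : Type*} [Fintype V] [Fintype W] {q : V → V → ℝ} {m : V → ℝ} {d : ℕ}
  {D δ K c ε : ℝ} (σ : W ≃ V)

theorem lap_comp_equiv (f : V → ℝ) :
    lap (full W) (fun a b => q (σ a) (σ b)) (f ∘ σ) = lap (full V) q f ∘ σ := by
  funext a
  exact σ.sum_comp fun y => q (σ a) y * (f y - f (σ a))

theorem gam_comp_equiv (f g : V → ℝ) :
    gam (full W) (fun a b => q (σ a) (σ b)) (f ∘ σ) (g ∘ σ) = gam (full V) q f g ∘ σ := by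
  funext a
  exact congrArg (1 / 2 * ·)
    (σ.sum_comp fun y => q (σ a) y * ((f y - f (σ a)) * (g y - g (σ a))))

theorem gam2_comp_equiv (f g : V → ℝ) :
    gam2 (full W) (fun a b => q (σ a) (σ b)) (f ∘ σ) (g ∘ σ) = gam2 (full V) q f g ∘ σ := by
  funext a
  simp only [gam2, lap_comp_equiv, gam_comp_equiv, Function.comp_apply]

theorem Regular.comp_equiv (h : Regular q m d D δ K c) :
    Regular (fun a b => q (σ a) (σ b)) (m ∘ σ) d D δ K c where
  nonneg _ _ := h.nonneg _ _
  diag _ := h.diag _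
  rev _ _ := h.rev _ _
  le_m _ := h.le_m _
  m_le _ := h.m_le _
  sum_le a := (σ.sum_comp fun y => q (σ a) y).trans_le (h.sum_le _)
  card_le a S hS := by
    obtain ⟨y, hy, h0⟩ := h.card_le (σ a) (S.map σ.toEmbedding) (by rwa [card_map])
    obtain ⟨b, hb, rfl⟩ := mem_map.1 hy
    exact ⟨b, hb, h0⟩
  cd f a := by
    obtain ⟨g, rfl⟩ : ∃ g : V → ℝ, f = g ∘ σ := ⟨f ∘ σ.symm, by funext; simp⟩
    rw [gam_comp_equiv, gam2_comp_equiv]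
    exact h.cd g (σ a)
  osc f a b := by
    obtain ⟨g, rfl⟩ : ∃ g : V → ℝ, f = g ∘ σ := ⟨f ∘ σ.symm, by funext; simp⟩
    rw [gam_comp_equiv]
    exact (h.osc g (σ a) (σ b)).trans_eq
      (congrArg (c * ·) (σ.sum_comp fun y => gam (full V) q g g y).symm)

theorem EigenFrame.comp_equiv {f : Fin d → V → ℝ} {μ : Fin d → ℝ}
    (hf : EigenFrame q m K ε f μ) :
    EigenFrame (fun a b => q (σ a) (σ b)) (m ∘ σ) K ε (fun i => f i ∘ σ) μ where
  orth i j := (σ.sum_comp fun x => m x * (f i x * f j x)).trans (hf.orth i j)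
  eig i a := by rw [lap_comp_equiv]; exact hf.eig i (σ a)
  le_mu := hf.le_mu
  mu_le := hf.mu_le

end Transport

/-- Relabelling by `Fin n` leaves one compactness problem for each n ≤ N; the thresholds have a
common positive lower bound. -/
theorem exists_gap_of_card_le (N d : ℕ) {D δ K c : ℝ} (hδ : 1 ≤ δ) (hc : 0 ≤ c) (hK : 0 < K)
    {η : ℝ} (hη : 0 < η) : ∃ ε₀ : ℝ, 0 < ε₀ ∧ ∀ (V : Type*) [Fintype V] [Nonempty V],
      Fintype.card V ≤ N → ∀ ε ≤ ε₀, ∀ (q : V → V → ℝ) (m : V → ℝ) (f : Fin d → V → ℝ)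
      (μ : Fin d → ℝ), Regular q m d D δ K c → EigenFrame q m K ε f μ →
      ∃ e : V ≃ (Fin d → Bool), ∀ x y, |q x y - cubeRate d K (e x) (e y)| < η := by
  have hev : ∀ᶠ t in nhdsWithin (0 : ℝ) (Set.Ioi 0), 0 < t ∧ ∀ n ∈ Finset.Icc 1 N,
      ∀ ε ≤ t, ∀ (q : Fin n → Fin n → ℝ) (m : Fin n → ℝ) (f : Fin d → Fin n → ℝ) (μ : Fin d → ℝ),
      Regular q m d D δ K c → EigenFrame q m K ε f μ →
      ∃ e : Fin n ≃ (Fin d → Bool), ∀ x y, |q x y - cubeRate d K (e x) (e y)| < η := by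
    refine eventually_mem_nhdsWithin.and ((Filter.eventually_all_finset _).2 fun n hn => ?_)
    obtain ⟨t, ht, hgap⟩ := exists_gap (d := d) (D := D) n (Finset.mem_Icc.1 hn).1 hδ hc hK hη
    filter_upwards [Ioo_mem_nhdsGT ht] with s hs ε hε
    exact hgap ε (hε.trans hs.2.le)
  obtain ⟨t, ht, hgap⟩ := hev.exists
  refine ⟨t, ht, fun V _ _ hcard ε hε q m f μ h hf => ?_⟩
  let σ := Fintype.equivFin V
  obtain ⟨e, he⟩ := hgap _ (Finset.mem_Icc.2 ⟨Fintype.card_pos, hcard⟩) ε hε _ _ _ _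
    (h.comp_equiv σ.symm) (hf.comp_equiv σ.symm)
  exact ⟨σ.trans e, fun x y => by simpa using he (σ x) (σ y)⟩

theorem card_cube (d : ℕ) : Fintype.card (Fin d → Bool) = 2 ^ d := by simp

/-! ### Removing D and δ from the stability constant -/

namespace Regular

variable {V : Type*} [Fintype V] {q : V → V → ℝ} {m : V → ℝ} {d : ℕ} {D δ K c : ℝ}
  (h : Regular q m d D δ K c) (hK : 0 < K) {e : V ≃ (Fin d → Bool)}
  (he : ∀ x y, |q x y - cubeRate d K (e x) (e y)| < K / 4)
include h hK he

omit [Fintype V] h hK in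
theorem lt_q_of_adj {x y : V} (hxy : (hypercubeGraph d).Adj (e x) (e y)) :
    K / 4 < q x y ∧ q x y < 3 * K / 4 := by
  have := he x y
  rw [cubeRate, if_pos hxy, abs_lt] at this
  constructor <;> linarith

/-- Rates on cube edges exceed K/4, and these already use up the d neighbours allowed at x. -/
theorem pos_iff_adj_of_near {x y : V} : 0 < q x y ↔ (hypercubeGraph d).Adj (e x) (e y) := by
  classical
  refine ⟨fun hy => ?_, fun hxy => (by positivity : 0 < K / 4).trans (lt_q_of_adj he hxy).1⟩
  set S : Finset V := univ.image fun i => e.symm (Function.update (e x) i (!e x i)) with hS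
  have hsub : S ⊆ univ.filter fun y => 0 < q x y := by
    intro z hz
    obtain ⟨i, -, rfl⟩ := mem_image.1 hz
    refine mem_filter.2 ⟨mem_univ _, (by positivity : 0 < K / 4).trans (lt_q_of_adj he ?_).1⟩
    rw [Equiv.apply_symm_apply]
    exact hypercubeGraph_adj_iff.2 ⟨i, rfl⟩
  have hcard : S.card = d := by
    rw [hS, card_image_of_injective, card_univ, Fintype.card_fin]
    intro i j hij
    have h1 := congrFun (e.symm.injective hij) i
    by_contra hne
    rw [Function.update_self, Function.update_of_ne hne] at h1
    simp at h1
  have heq := eq_of_subset_of_card_le hsub (by rw [hcard]; exact h.card_pos_le x)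
  have hmem : y ∈ S := by rw [heq]; simp [hy]
  obtain ⟨i, -, rfl⟩ := mem_image.1 hmem
  rw [Equiv.apply_symm_apply]
  exact hypercubeGraph_adj_iff.2 ⟨i, rfl⟩

/-- By reversibility m y / m x = q(x,y)/q(y,x) < 3 on an edge, and the cube has diameter d. -/
theorem m_le_of_near (hδ : 0 < δ) (x y : V) : m y ≤ 3 ^ d * m x := by
  classical
  have hedge : ∀ x y, (hypercubeGraph d).Adj (e x) (e y) → m y ≤ 3 * m x := by
    intro x y hxy
    have h1 := lt_q_of_adj he hxy
    have h2 := lt_q_of_adj he hxy.symm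
    have h3 := h.rev x y
    have hx := h.m_pos hδ x
    have hy := h.m_pos hδ y
    have h4 : m y * (K / 4) ≤ 3 * m x * (K / 4) := by nlinarith
    exact le_of_mul_le_mul_right h4 (by positivity)
  -- Flip the coordinates in s one at a time, losing a factor 3 each.
  have key : ∀ s : Finset (Fin d),
      m (e.symm fun i => if i ∈ s then !e x i else e x i) ≤ 3 ^ s.card * m x := by
    intro s
    induction s using Finset.induction_on with
    | empty => simp
    | insert a s ha ih =>
      rw [card_insert_of_notMem ha, pow_succ', mul_assoc]
      refine (hedge (e.symm fun i => if i ∈ s then !e x i else e x i) _ ?_).trans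
        (mul_le_mul_of_nonneg_left ih (by norm_num))
      rw [Equiv.apply_symm_apply, Equiv.apply_symm_apply]
      refine hypercubeGraph_adj_iff.2 ⟨a, funext fun j => ?_⟩
      by_cases hj : j = a
      · subst hj; simp [ha]
      · simp [hj]
  have h1 := key (univ.filter fun i => e x i ≠ e y i)
  have h2 : (e.symm fun i => if i ∈ univ.filter (fun i => e x i ≠ e y i) then !e x i else e x i) =
      y := by
    rw [Equiv.symm_apply_eq]
    funext i
    cases h3 : e x i <;> cases h4 : e y i <;> simp [h3, h4]
  rw [h2] at h1
  refine h1.trans (mul_le_mul_of_nonneg_right ?_ (h.m_pos hδ x).le)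
  exact pow_le_pow_right₀ (by norm_num) ((card_le_univ _).trans_eq (Fintype.card_fin d))

/-- CD depends on q only, so m may be rescaled. The new bounds dK and 3^d no longer involve D and δ.
-/
theorem normalized_of_near (hδ : 0 < δ) (x₀ : V) :
    Regular q (fun x => m x / m x₀) d (d * K) (3 ^ d) K (oscConst (d * K) K) := by
  have h0 := h.m_pos hδ x₀
  refine Regular.of_connected hK h.nonneg h.diag (fun x y => ?_) (fun x => ?_) (fun x => ?_)
    (fun x => ?_) h.card_le h.cd (h.reflTransGen hδ)
  · rw [div_mul_eq_mul_div, div_mul_eq_mul_div, h.rev]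
  · rw [le_div_iff₀ h0, inv_mul_le_iff₀ (by positivity)]
    exact h.m_le_of_near hK he hδ x x₀
  · rw [div_le_iff₀ h0]
    exact h.m_le_of_near hK he hδ x₀ x
  · rw [← sum_filter_add_sum_filter_not univ (fun y => 0 < q x y)]
    have e1 : ∑ y ∈ univ.filter (fun y => ¬0 < q x y), q x y = 0 :=
      sum_eq_zero fun y hy => le_antisymm (not_lt.1 (mem_filter.1 hy).2) (h.nonneg x y)
    rw [e1, add_zero]
    calc ∑ y ∈ univ.filter (fun y => 0 < q x y), q x y
        ≤ ∑ _y ∈ univ.filter (fun y => 0 < q x y), K := by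
          refine sum_le_sum fun y hy => ?_
          have := (lt_q_of_adj he ((h.pos_iff_adj_of_near hK he).1 (mem_filter.1 hy).2)).2
          linarith
      _ ≤ d * K := by
          rw [sum_const, nsmul_eq_mul]
          exact mul_le_mul_of_nonneg_right (by exact_mod_cast h.card_pos_le x) hK.le

/-- The constant in the stability estimate. -/
noncomputable def _root_.GraphKernel.stabilityConst (d : ℕ) (K : ℝ) : ℝ :=
  Position.rateError (2 ^ d) d (d * K) K (K / 4)
    (Real.sqrt (3 ^ d * (2 ^ d : ℕ) / K) * 3 ^ d)
    (EigenFrame.gramConst (2 ^ d) (d * K) (3 ^ d) K (oscConst (d * K) K)) 1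

theorem abs_q_sub_cubeRate_le (hδ : 0 < δ) {ε : ℝ} (hε : 0 ≤ ε) (hε1 : ε ≤ 1)
    {f : Fin d → V → ℝ} {μ : Fin d → ℝ} (hf : EigenFrame q m K ε f μ) (x y : V) :
    |q x y - cubeRate d K (e x) (e y)| ≤ stabilityConst d K * Real.sqrt ε := by
  have hcard : Fintype.card V = 2 ^ d := (Fintype.card_congr e).trans (card_cube d)
  have h' := h.normalized_of_near hK he hδ x
  have h3 : (1 : ℝ) ≤ 3 ^ d := one_le_pow₀ (by norm_num)
  have hmx := h.m_pos hδ x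
  have hf' : EigenFrame q (fun z => m z / m x) K ε (fun i => Real.sqrt (m x) • f i) μ := by
    refine ⟨fun i j => ?_, fun i z => ?_, hf.le_mu, hf.mu_le⟩
    · rw [← hf.orth i j]
      refine sum_congr rfl fun z _ => ?_
      have := Real.mul_self_sqrt hmx.le
      simp only [Pi.smul_apply, smul_eq_mul]
      field_simp
      rw [Real.sq_sqrt hmx.le]
    · rw [lap_smul, Pi.smul_apply, Pi.smul_apply, hf.eig, smul_eq_mul, smul_eq_mul]; ring
  have hP := hf'.position h' h3 (oscConst_nonneg _ _) hK hε hε1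
  rw [hcard] at hP
  have hG := EigenFrame.gramConst_nonneg (2 ^ d) (d * K) (oscConst (d * K) K)
    (δ := 3 ^ d) (by positivity) hK.le
  have hrate : Position.rateError (2 ^ d) d (d * K) K (K / 4)
      (Real.sqrt (3 ^ d * (2 ^ d : ℕ) / K) * 3 ^ d)
      (EigenFrame.gramConst (2 ^ d) (d * K) (3 ^ d) K (oscConst (d * K) K) * Real.sqrt ε) ε ≤
      stabilityConst d K * Real.sqrt ε := by
    -- `rateError` is linear in (s, ε), and s is a multiple of √ε. Replacing ε by √ε pulls the
    -- factor out, leaving the value at ε = 1.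
    have hs : ε ≤ Real.sqrt ε := Real.le_sqrt_of_sq_le (by nlinarith)
    unfold stabilityConst Position.rateError Position.radialError
    have : (d * K) * (d * (2 * (Real.sqrt (3 ^ d * (2 ^ d : ℕ) / K) * 3 ^ d) ^ 2 * ε)) ≤
        (d * K) * (d * (2 * (Real.sqrt (3 ^ d * (2 ^ d : ℕ) / K) * 3 ^ d) ^ 2 * Real.sqrt ε)) := by
      gcongr
    linarith
  by_cases hxy : (hypercubeGraph d).Adj (e x) (e y)
  · have := hP.abs_q_sub_le h' hK.le (by positivity : 0 < K / 4) (lt_q_of_adj he hxy).1.le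
      (lt_q_of_adj he hxy.symm).1.le
    rw [hcard] at this
    rw [cubeRate, if_pos hxy]
    exact this.trans hrate
  · have hq : q x y = 0 := le_antisymm
      (not_lt.1 fun hq => hxy ((h.pos_iff_adj_of_near hK he).1 hq)) (h.nonneg x y)
    rw [cubeRate, if_neg hxy, hq, sub_zero, abs_zero]
    refine mul_nonneg ?_ (Real.sqrt_nonneg ε)
    unfold stabilityConst Position.rateError Position.radialError
    positivity

end Regular

end GraphKernel

/-! ### Frobenius distance and conclusion -/

theorem WeightedGraph.hypercube_q {d : ℕ} {K : ℝ} (hK : 0 < K / 2) (a b : Fin d → Bool) :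
    (WeightedGraph.hypercube d (K / 2) hK).q a b = GraphKernel.cubeRate d K a b := by
  simp [WeightedGraph.q, WeightedGraph.hypercube, GraphKernel.cubeRate]

theorem WeightedGraph.frobeniusDist_hypercube_le {V : Type*} [Fintype V] (G : WeightedGraph V)
    {d : ℕ} {K : ℝ} (hK : 0 < K / 2) (e : V ≃ (Fin d → Bool)) {r : ℝ} (hr : 0 ≤ r)
    (he : ∀ x y, |G.q x y - GraphKernel.cubeRate d K (e x) (e y)| ≤ r) :
    G.frobeniusDist (WeightedGraph.hypercube d (K / 2) hK) ≤ 2 ^ d * r := by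
  refine (ciInf_le (Set.finite_range _).bddBelow e).trans ?_
  refine Real.sqrt_le_iff.2 ⟨by positivity, ?_⟩
  have hentry : ∀ a b, (G.edgeDegreeMatrix.submatrix e.symm e.symm -
      (WeightedGraph.hypercube d (K / 2) hK).edgeDegreeMatrix) a b ^ 2 ≤ r ^ 2 := by
    intro a b
    have := he (e.symm a) (e.symm b)
    rw [Equiv.apply_symm_apply, Equiv.apply_symm_apply] at this
    rw [← sq_abs]
    refine pow_le_pow_left₀ (abs_nonneg _) ?_ 2
    simpa [WeightedGraph.edgeDegreeMatrix, WeightedGraph.hypercube_q] using this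
  refine (Finset.sum_le_sum fun a _ => Finset.sum_le_sum fun b _ => hentry a b).trans_eq ?_
  simp only [Finset.sum_const, Finset.card_univ, GraphKernel.card_cube, nsmul_eq_mul]
  push_cast
  ring

theorem mainTheorem1 (d : ℕ) (hd : 0 < d) (K : ℝ) (hK : 0 < K) :
    ∃ C : ℝ, 0 < C ∧
      ∀ (D : ℝ), 0 < D → ∀ (δ : ℝ), 1 < δ →
        ∃ ε₀ : ℝ, 0 < ε₀ ∧
          ∀ (V : Type*) (G : WeightedGraph V), G.MemClass D d δ → G.CDInfty K →
            Finite V ∧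
            ∀ [Fintype V], G.eigenvalue d ≤ K + ε₀ →
              Nonempty (G.toSimpleGraph ≃g hypercubeGraph d) ∧
              G.frobeniusDist (WeightedGraph.hypercube d (K / 2) (half_pos hK)) ≤
                C * Real.sqrt (G.eigenvalue d - K) := by
  -- 2^d is the square root of the number of matrix entries; the +1 makes the constant positive.
  refine ⟨2 ^ d * |GraphKernel.stabilityConst d K| + 1, by positivity, fun D hD δ hδ => ?_⟩
  obtain ⟨t, ht, hgap⟩ := GraphKernel.exists_gap_of_card_le (WeightedGraph.cardBound D d K) d
    (D := D) hδ.le (GraphKernel.oscConst_nonneg D K) hK (by positivity : 0 < K / 4)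
  refine ⟨min t 1, lt_min ht one_pos, fun V G hG hCD => ⟨hG.finite hK hCD, ?_⟩⟩
  intro _ hle
  classical
  have hδ0 : 0 < δ := by linarith
  have hreg := hG.regular hK hCD
  have : Nonempty V := hG.connected.nonempty
  obtain ⟨φ, ν, horth, heig, hroots⟩ := G.exists_eigenbasis
  obtain ⟨f, μ, hf⟩ := hreg.exists_eigenFrame hδ0 (φ := φ) (ν := ν)
    (fun i j => by rw [horth])
    (fun i x => by
      rw [← heig, WeightedGraph.laplacian_eq_lap (N := GraphKernel.full V)
        fun _ y _ => Finset.mem_univ y])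
    -- A vertex of degree d and its neighbours give |V| > d, so λ_d is a genuine eigenvalue and not
    -- the default 0 of `getD`.
    (G.lt_card_eigenvalue_le hroots (hG.lt_card hd))
  have hε : 0 ≤ G.eigenvalue d - K := by
    have := hf.le_mu ⟨0, hd⟩
    have := hf.mu_le ⟨0, hd⟩
    linarith
  obtain ⟨e, he⟩ := hgap V (hG.card_le hK hCD) _ (by linarith [min_le_left t 1]) _ _ _ _ hreg hf
  refine ⟨⟨⟨e, fun {x y} => ?_⟩⟩, ?_⟩
  · rw [← hreg.pos_iff_adj_of_near hK he, WeightedGraph.q_pos_iff]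
  · have hstab := hreg.abs_q_sub_cubeRate_le hK he hδ0 hε (by linarith [min_le_right t 1]) hf
    have hs := Real.sqrt_nonneg (G.eigenvalue d - K)
    refine (G.frobeniusDist_hypercube_le (half_pos hK) e
      (r := |GraphKernel.stabilityConst d K| * Real.sqrt (G.eigenvalue d - K)) (by positivity)
      fun x y => (hstab x y).trans
        (mul_le_mul_of_nonneg_right (le_abs_self _) hs)).trans ?_
    rw [← mul_assoc]
    exact mul_le_mul_of_nonneg_right (by linarith) hs
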